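/- Let $f:S^2\to S^2$ be a topologically coarse expanding conformal (cxc) map with finite postcritical set. Then the virtual endomorphism of the orbifold fundamental group induced by $f$ is contracting. Here the terms have the following meaning. *Branched covering and postcritical set.* A map $f:S^2\to S^2$ is a branched covering if it is continuous and near each point $x$ has, in suitable complex coordinates centred at $x$ and $f(x)$, the form $z\mapsto z^{k}$ with $k\ge1$; then $\deg(f,x)=k$. Iterates are denoted $f^n$. The postcritical set is $P=\bigcup_{n>0}f^{n}(\{x:\deg(f,x)>1\})$. *Topologically cxc.* A branched covering $f:S^2\to S^2$ of degree at least $2$ is topologically cxc if there is a finite cover $\mathcal U_0$ of $S^2$ by connected open sets such that, with $\mathcal U_n$ the set of connected components of the sets $f^{-n}(U)$, $U\in\mathcal U_0$: (Expansion) for every finite open cover $\mathcal Y$ of $S^2$ there is $N$ such that for all $n\ge N$ each element of $\mathcal U_n$ is contained in an element of $\mathcal Y$; (Irreducibility) for every $x\in S^2$ and every neighbourhood $W$ of $x$ there is $n$ with $f^n(W)=S^2$; (Degree) the degrees of all maps $f^k:\widetilde U\to U$, with $U\in\mathcal U_n$, $\widetilde U\in\mathcal U_{n+k}$, $f^k(\widetilde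 U)=U$ and $n,k\ge0$, are bounded. *Orbifold fundamental groups.* Put $\nu_0(y)=\operatorname{lcm}\{\deg(f^n,x): f^n(x)=y\}$, $\nu_1(x)=\nu_0(f(x))/\deg(f,x)$, $U_0=S^2\setminus P$ and $U_1=S^2\setminus f^{-1}(P)\subset U_0$. Let $\pi_1(\mathcal O_i,b)$ be the quotient of $\pi_1(U_i,b)$ by the normal subgroup generated by the elements $g^{\nu_i(x)}$, where $x$ is a puncture of $U_i$ with $\nu_i(x)<\infty$ and $g$ is peripheral at $x$, i.e. represented by a loop freely homotopic in $U_i$ into arbitrarily small neighbourhoods of $x$. *Virtual endomorphism.* Choose $b_0\in U_0$, $b_1\in f^{-1}(b_0)$ and a path $\alpha$ in $U_0$ from $b_1$ to $b_0$, and put $G=\pi_1(\mathcal O_0,b_0)$. The covering $f:U_1\to U_0$, the inclusion $\iota:U_1\to U_0$ and transport along $\alpha$ induce homomorphisms $\bar f_*:\pi_1(\mathcal O_1,b_1)\to G$, $\bar\iota_*:\pi_1(\mathcal O_1,b_1)\to\pi_1(\mathcal O_0,b_1)$ and $\bar\alpha_*:\pi_1(\mathcal O_0,b_1)\to G$; the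 first is injective and its image $H$ has finite index in $G$. The virtual endomorphism is $\phi=\bar\alpha_*\circ\bar\iota_*\circ(\bar f_*)^{-1}:H\to G$. Its iterate $\phi^n$ has domain $\operatorname{dom}\phi^n=\{g\in H:\phi(g)\in\operatorname{dom}\phi^{n-1}\}$, where $\operatorname{dom}\phi^1=H$. *Contracting.* The group $G$ is finitely generated, and $\phi$ is contracting if, for every finite generating set of $G$ with word length $\|\cdot\|$, $$\limsup_{n\to\infty}\Bigl(\limsup_{\|g\|\to\infty,\ g\in\operatorname{dom}\phi^n}\frac{\|\phi^n(g)\|}{\|g\|}\Bigr)^{1/n}<1 .$$ The statement holds for every choice of $b_0$, $b_1$ and $\alpha$. The assertions made above that these homomorphisms are well defined, that $\bar f_*$ is injective, that $H$ has finite index and that $G$ is finitely generated are part of the claim. -/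

import Mathlib

open Set Filter Topology
open scoped ENNReal

noncomputable section

/-- The two-sphere. -/
abbrev Sphere2 : Type := Metric.sphere (0 : EuclideanSpace ℝ (Fin 3)) 1

/-! ### Branched coverings and expansion -/

/-- A branched covering between surfaces, here for a self-map: a continuous map which at every
point `x` has, in suitable complex coordinates centred at `x` and at `f x`, the form `z ↦ z ^ k`
for some `k ≥ 1`. The coordinates may reverse the orientation. -/
def IsBranchedCovering {X : Type*} [TopologicalSpace X] (f : X → X) : Prop :=
  Continuous f ∧ ∀ x : X, ∃ k : ℕ, 1 ≤ k ∧ ∃ φ ψ : OpenPartialHomeomorph X ℂ,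
    x ∈ φ.source ∧ f x ∈ ψ.source ∧ φ x = 0 ∧ ψ (f x) = 0 ∧
    MapsTo f φ.source ψ.source ∧ ∀ y ∈ φ.source, ψ (f y) = φ y ^ k

/-- The local degree of `f` at `x`: the maximal number of preimages, near `x`, of a point. -/
def localDegree {X : Type*} [TopologicalSpace X] (f : X → X) (x : X) : ℕ :=
  (⨅ W ∈ 𝓝 x, ⨆ y : X, (W ∩ f ⁻¹' {y}).encard : ℕ∞).toNat

/-- The covering `𝓤_n`: all connected components of the sets `f⁻ⁿ(U)`, `U ∈ 𝓤₀`. -/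
def pullbackCover {X : Type*} [TopologicalSpace X] (f : X → X) (𝓤₀ : Set (Set X)) (n : ℕ) :
    Set (Set X) :=
  {V | ∃ U ∈ 𝓤₀, ∃ x ∈ f^[n] ⁻¹' U, V = connectedComponentIn (f^[n] ⁻¹' U) x}

/-- Axiom [Expansion]: the mesh of the coverings `𝓤_n` tends to zero. -/
def AxiomExpansion {X : Type*} [TopologicalSpace X] (f : X → X) (𝓤₀ : Set (Set X)) : Prop :=
  ∀ 𝓨 : Set (Set X), 𝓨.Finite → (∀ Y ∈ 𝓨, IsOpen Y) → ⋃₀ 𝓨 = univ →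
    ∃ N : ℕ, ∀ n ≥ N, ∀ U ∈ pullbackCover f 𝓤₀ n, ∃ Y ∈ 𝓨, U ⊆ Y

/-- Axiom [Irreducibility]: the map is locally eventually onto. -/
def AxiomIrreducibility {X : Type*} [TopologicalSpace X] (f : X → X) : Prop :=
  ∀ x : X, ∀ W ∈ 𝓝 x, ∃ n : ℕ, f^[n] '' W = univ

/-- Axiom [Degree]: the degrees of the maps `f^k : V → U`, where `U ∈ 𝓤_n`, `V ∈ 𝓤_{n+k}`, are
bounded; the degree of such a map is the maximal cardinality of its fibres. -/
def AxiomDegree {X : Type*} [TopologicalSpace X] (f : X → X) (𝓤₀ : Set (Set X)) : Prop :=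
  ∃ p : ℕ, ∀ n k : ℕ, ∀ U ∈ pullbackCover f 𝓤₀ n, ∀ V ∈ pullbackCover f 𝓤₀ (n + k),
    f^[k] '' V = U → ∀ y ∈ U, (V ∩ f^[k] ⁻¹' {y}).encard ≤ p

/-- Topologically coarse expanding conformal (cxc) self-maps of a compact surface: branched
coverings of degree at least two such that, for some finite covering of the surface by connected
open sets, the axioms [Expansion], [Irreducibility] and [Degree] hold. -/
def IsTopologicallyCXC {X : Type*} [TopologicalSpace X] (f : X → X) : Prop :=
  IsBranchedCovering f ∧ (∃ y : X, 2 ≤ (f ⁻¹' {y}).encard) ∧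
  ∃ 𝓤₀ : Set (Set X), 𝓤₀.Finite ∧ (∀ U ∈ 𝓤₀, IsOpen U ∧ IsConnected U) ∧ ⋃₀ 𝓤₀ = univ ∧
    AxiomExpansion f 𝓤₀ ∧ AxiomIrreducibility f ∧ AxiomDegree f 𝓤₀

/-- The postcritical set `⋃_{n > 0} fⁿ({branch points})`. -/
def postcriticalSet {X : Type*} [TopologicalSpace X] (f : X → X) : Set X :=
  ⋃ n : ℕ, f^[n + 1] '' {x | 1 < localDegree f x}

theorem map_mem_postcriticalSet {X : Type*} [TopologicalSpace X] (f : X → X) {x : X}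
    (hx : x ∈ postcriticalSet f) : f x ∈ postcriticalSet f := by
  simp only [postcriticalSet, mem_iUnion] at hx ⊢
  obtain ⟨n, c, hc, rfl⟩ := hx
  exact ⟨n + 1, c, hc, Function.iterate_succ_apply' f (n + 1) c⟩

/-! ### Orbifold fundamental groups -/

/-- The weight `ν₀(y) = lcm {deg(fⁿ, x) : fⁿ(x) = y}`. The weight `∞` is encoded as `0`. -/
def weight₀ {X : Type*} [TopologicalSpace X] (f : X → X) (y : X) : ℕ :=
  sInf {m : ℕ | 0 < m ∧ ∀ (n : ℕ) (x : X), f^[n] x = y → localDegree f^[n] x ∣ m}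

/-- The weight `ν₁(x) = ν₀(f(x)) / deg(f, x)`. The weight `∞` is encoded as `0`. -/
def weight₁ {X : Type*} [TopologicalSpace X] (f : X → X) (x : X) : ℕ :=
  weight₀ f (f x) / localDegree f x

/-- An element of `π₁(U, b)` is peripheral at `x` if it is represented by a loop which is freely
homotopic in `U` into arbitrarily small neighbourhoods of `x`: one follows a path `δ` from `b` to a
point near `x`, then a loop `β` near `x`, and returns along `δ`. -/
def IsPeripheral {X : Type*} [TopologicalSpace X] {U : Set X} {b : U} (x : X)
    (g : FundamentalGroup U b) : Prop :=
  ∀ V ∈ 𝓝 x, ∃ (c : U) (δ : Path b c) (β : Path c c), (∀ t, (β t : X) ∈ V) ∧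
    g = FundamentalGroup.fromPath (Path.Homotopic.Quotient.mk ((δ.trans β).trans δ.symm))

/-- The normal subgroup of `π₁(U, b)` generated by the `ν(x)`-th powers of the elements that are
peripheral at a puncture `x` of `U`. (At a puncture of a surface the peripheral elements are the
powers of those given by simple loops around `x`, so that the latter generate the same normal
subgroup. A puncture of infinite weight, `ν x = 0`, contributes nothing.) -/
def orbifoldKernel {X : Type*} [TopologicalSpace X] (U : Set X) (ν : X → ℕ) (b : U) :
    Subgroup (FundamentalGroup U b) :=
  Subgroup.normalClosure {h | ∃ x ∉ U, ∃ g : FundamentalGroup U b, IsPeripheral x g ∧ h = g ^ ν x}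

instance orbifoldKernel_normal {X : Type*} [TopologicalSpace X] (U : Set X) (ν : X → ℕ) (b : U) :
    (orbifoldKernel U ν b).Normal :=
  Subgroup.normalClosure_normal

/-- The fundamental group of the orbifold with weight function `ν` and singular points
(of weight larger than one) in the complement of `U`. -/
abbrev OrbifoldGroup {X : Type*} [TopologicalSpace X] (U : Set X) (ν : X → ℕ) (b : U) : Type _ :=
  FundamentalGroup U b ⧸ orbifoldKernel U ν b

/-! ### The virtual endomorphism -/

/-- `U₀ = X ∖ P`, where `P` is the postcritical set. -/
def regularSet₀ {X : Type*} [TopologicalSpace X] (f : X → X) : Set X :=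
  (postcriticalSet f)ᶜ

/-- `U₁ = X ∖ f⁻¹(P)`. -/
def regularSet₁ {X : Type*} [TopologicalSpace X] (f : X → X) : Set X :=
  (f ⁻¹' postcriticalSet f)ᶜ

/-- The covering `f : U₁ → U₀`. -/
def regularCovering {X : Type*} [TopologicalSpace X] (f : C(X, X)) :
    C(regularSet₁ f, regularSet₀ f) where
  toFun x := ⟨f x, x.2⟩
  continuous_toFun := (f.continuous.comp continuous_subtype_val).subtype_mk _

/-- The inclusion `U₁ ⊆ U₀`. -/
def regularInclusion {X : Type*} [TopologicalSpace X] (f : C(X, X)) :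
    C(regularSet₁ f, regularSet₀ f) where
  toFun x := ⟨x, fun hx => x.2 (map_mem_postcriticalSet f hx)⟩
  continuous_toFun := continuous_subtype_val.subtype_mk _

/-- `π₁(𝒪₀, b₀)` -/
abbrev OrbifoldGroup₀ {X : Type*} [TopologicalSpace X] (f : C(X, X)) (b₀ : regularSet₀ f) :
    Type _ :=
  OrbifoldGroup (regularSet₀ f) (weight₀ f) b₀

/-- `π₁(𝒪₁, b₁)` -/
abbrev OrbifoldGroup₁ {X : Type*} [TopologicalSpace X] (f : C(X, X)) (b₁ : regularSet₁ f) :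
    Type _ :=
  OrbifoldGroup (regularSet₁ f) (weight₁ f) b₁

/-- `φ : H → G = π₁(𝒪₀, b₀)` is the virtual endomorphism induced by `f`, for the base point
`b₀ = f(b₁)`, its preimage `b₁` and the connecting path `α` in `U₀` from `b₁` to `b₀`.
That is: the homomorphisms `f_*`, `ι_*` and `α_*` of fundamental groups descend to homomorphisms
`F : π₁(𝒪₁, b₁) → π₁(𝒪₀, b₀)`, `I : π₁(𝒪₁, b₁) → π₁(𝒪₀, b₁)` and
`A : π₁(𝒪₀, b₁) → π₁(𝒪₀, b₀)`, the homomorphism `F` is injective with image `H`, and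
`φ = A ∘ I ∘ F⁻¹`. The pair `(H, φ)` is uniquely determined by this. -/
def IsVirtualEndomorphism {X : Type*} [TopologicalSpace X] (f : C(X, X)) (b₁ : regularSet₁ f)
    (α : Path (regularInclusion f b₁) (regularCovering f b₁))
    (H : Subgroup (OrbifoldGroup₀ f (regularCovering f b₁)))
    (φ : H →* OrbifoldGroup₀ f (regularCovering f b₁)) : Prop :=
  ∃ (F : OrbifoldGroup₁ f b₁ →* OrbifoldGroup₀ f (regularCovering f b₁))
    (I : OrbifoldGroup₁ f b₁ →* OrbifoldGroup₀ f (regularInclusion f b₁))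
    (A : OrbifoldGroup₀ f (regularInclusion f b₁) →* OrbifoldGroup₀ f (regularCovering f b₁)),
    (∀ g : FundamentalGroup (regularSet₁ f) b₁,
      F (QuotientGroup.mk g) =
        QuotientGroup.mk (FundamentalGroup.map (regularCovering f) b₁ g)) ∧
    (∀ g : FundamentalGroup (regularSet₁ f) b₁,
      I (QuotientGroup.mk g) =
        QuotientGroup.mk (FundamentalGroup.map (regularInclusion f) b₁ g)) ∧
    (∀ g : FundamentalGroup (regularSet₀ f) (regularInclusion f b₁),
      A (QuotientGroup.mk g) =
        QuotientGroup.mk (FundamentalGroup.fundamentalGroupMulEquivOfPath α g)) ∧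
    Function.Injective F ∧ H = F.range ∧
    ∀ (h : H) (x : OrbifoldGroup₁ f b₁), F x = h → φ h = A (I x)

/-! ### Contraction -/

/-- The word length of `g` with respect to `S`: the least length of a word in the elements of `S`
and their inverses which represents `g`. -/
def wordLength {G : Type*} [Group G] (S : Set G) (g : G) : ℕ :=
  sInf {n : ℕ | ∃ l : List G, l.length = n ∧ (∀ s ∈ l, s ∈ S ∨ s⁻¹ ∈ S) ∧ l.prod = g}

open Classical in
/-- A homomorphism `φ : H → G` extended by `1` outside of `H`. -/
def extendByOne {G : Type*} [Group G] {H : Subgroup G} (φ : H →* G) (g : G) : G :=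
  if hg : g ∈ H then φ ⟨g, hg⟩ else 1

/-- The domain of the `n`-th iterate `φⁿ`; on it, `φⁿ` is the `n`-fold iterate of
`extendByOne φ`. -/
def iterateDomain {G : Type*} [Group G] {H : Subgroup G} (φ : H →* G) : ℕ → Set G
  | 0 => univ
  | n + 1 => {g | ∃ hg : g ∈ H, φ ⟨g, hg⟩ ∈ iterateDomain φ n}

/-- The contraction ratio
`ρ = limsup_{n → ∞} (limsup_{‖g‖ → ∞} ‖φⁿ(g)‖ / ‖g‖) ^ (1/n)`, where `g` ranges over the domain
of `φⁿ`; it takes values in `[0, ∞]`. -/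
def contractionRatio {G : Type*} [Group G] (S : Set G) {H : Subgroup G} (φ : H →* G) : ℝ≥0∞ :=
  limsup (fun n : ℕ =>
    (limsup (fun g : G => (wordLength S ((extendByOne φ)^[n] g) : ℝ≥0∞) / (wordLength S g : ℝ≥0∞))
      (comap (wordLength S) atTop ⊓ 𝓟 (iterateDomain φ n))) ^ (1 / (n : ℝ))) atTop

/-- A virtual endomorphism `φ : H → G` of a finitely generated group is contracting if its
contraction ratio, with respect to any finite generating set, is less than one. -/
def IsContracting {G : Type*} [Group G] {H : Subgroup G} (φ : H →* G) : Prop :=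
  Group.FG G ∧
    ∀ S : Set G, S.Finite → Subgroup.closure S = ⊤ → contractionRatio S φ < 1

end

/-!
The virtual endomorphism of a topologically cxc map `f` of the sphere with finite postcritical set
`P` contracts because lifting through `fⁿ` makes paths short.

*The homomorphisms.* Over `U₀ = S² ∖ P` the map `f` is a covering with finite fibres. Near a puncture
it is the power map `z ↦ z ^ k`. In the half-plane `{re w < log r}`, which covers the punctured disc by
`w ↦ exp w`, the power map is multiplication by `k`, so that a circle traversed `m` times goes to a
circle traversed `k m` times. Since `k ν₁(x) = ν₀(f x)`, the map `f` carries the relations of `π₁(𝒪₁)`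
to those of `π₁(𝒪₀)` (`map_regularCovering_mem_orbifoldKernel`), and conversely the relations of
`π₁(𝒪₀)` lift (`exists_map_eq_of_mem_orbifoldKernel`), which gives injectivity. That the weights are
finite is where the axiom [Degree] enters: it bounds the local degrees of all iterates
(`IsTopologicallyCXC.exists_localDegree_le`). These facts are collected in
`exists_isVirtualEndomorphism`.

*The alphabet.* As the weights are finite, a small disc around a puncture carries only finitely many
loops up to the relations of the orbifold group. Hence paths of diameter less than some `ε`, with end
points moved to a finite net, represent finitely many classes, and a loop which is a product of `n`
such paths is a word of length `n` in a finite alphabet (`exists_finite_alphabet`). In particular the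
group is finitely generated.

*Contraction.* If `d` is a loop with class in the domain of `φⁿ`, then `φⁿ` maps its class to that of
a lift of `d` through `fⁿ`, joined to the base point by a path depending only on `n`
(`exists_iterate_eq`). A word of length `w` is represented by a loop made of at most `K w` paths each
running in a member of the cover `𝓤₀`. By the axiom [Expansion] their lifts are, for all large `n`, so
small that any `M` consecutive ones form a path of diameter less than `ε`. Thus the length of the image
is at most `C K w / M` plus a constant, and a large `M` makes the factor at most `1 / 2`
(`IsTopologicallyCXC.contractionRatio_lt_one`).
-/

noncomputable section

/-! ### Homotopy classes of paths and their cost with respect to a cover -/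

/-- Homotopy classes, relative to the end points, of paths from `x` to `y`. -/
abbrev PathClass {Y : Type*} [TopologicalSpace Y] (x y : Y) : Type _ :=
  Path.Homotopic.Quotient x y

namespace PathClass

variable {Y Z : Type*} [TopologicalSpace Y] [TopologicalSpace Z] {x y z : Y}

@[simp] theorem symm_trans_cancel (c : PathClass x y) (d : PathClass y z) :
    c.symm.trans (c.trans d) = d := by
  rw [← Path.Homotopic.Quotient.trans_assoc]; simp

@[simp] theorem trans_symm_cancel (c : PathClass x y) (d : PathClass x z) :
    c.trans (c.symm.trans d) = d := by
  rw [← Path.Homotopic.Quotient.trans_assoc]; simp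

@[simp] theorem symm_symm (c : PathClass x y) : c.symm.symm = c := by
  induction c using Path.Homotopic.Quotient.ind with | mk p =>
  rw [← Path.Homotopic.Quotient.mk_symm, ← Path.Homotopic.Quotient.mk_symm, Path.symm_symm]

@[simp] theorem symm_trans_rev (c : PathClass x y) (d : PathClass y z) :
    (c.trans d).symm = d.symm.trans c.symm := by
  induction c using Path.Homotopic.Quotient.ind with | mk p =>
  induction d using Path.Homotopic.Quotient.ind with | mk q =>
  simp only [← Path.Homotopic.Quotient.mk_symm, ← Path.Homotopic.Quotient.mk_trans,
    Path.trans_symm]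

@[simp] theorem symm_refl (x : Y) :
    (Path.Homotopic.Quotient.refl x).symm = Path.Homotopic.Quotient.refl x := rfl

@[simp] theorem map_trans (f : C(Y, Z)) (c : PathClass x y) (d : PathClass y z) :
    (c.trans d).map f = (c.map f).trans (d.map f) := by
  induction c using Path.Homotopic.Quotient.ind with | mk p =>
  induction d using Path.Homotopic.Quotient.ind with | mk q =>
  simp only [← Path.Homotopic.Quotient.mk_map, ← Path.Homotopic.Quotient.mk_trans,
    Path.map_trans]

@[simp] theorem map_symm (f : C(Y, Z)) (c : PathClass x y) :
    c.symm.map f = (c.map f).symm := by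
  induction c using Path.Homotopic.Quotient.ind with | mk p => rfl

end PathClass

theorem IsCoveringMap.exists_path_lift {E Y : Type*} [TopologicalSpace E] [TopologicalSpace Y]
    {f : C(E, Y)} (cov : IsCoveringMap f) {e : E} {y : Y} (p : Path (f e) y) :
    ∃ (e' : E) (q : Path e e'), f e' = y ∧ ∀ t, f (q t) = p t := by
  have hl := cov.liftPath_lifts p e p.source
  exact ⟨_, ⟨cov.liftPath p e p.source, cov.liftPath_zero p e p.source, rfl⟩,
    (congr_fun hl 1).trans p.target, congr_fun hl⟩

/-- `HasCost 𝓦 c n`: the class `c` is the product of the classes of `n` paths each of which runs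
in a member of `𝓦`. -/
inductive HasCost {Y : Type*} [TopologicalSpace Y] (𝓦 : Set (Set Y)) :
    ∀ {x y : Y}, PathClass x y → ℕ → Prop
  | nil (x : Y) : HasCost 𝓦 (Path.Homotopic.Quotient.refl x) 0
  | cons {x y z : Y} (p : Path x y) (c : PathClass y z) (n : ℕ) (W : Set Y) (hW : W ∈ 𝓦)
      (hp : ∀ t, p t ∈ W) (hc : HasCost 𝓦 c n) : HasCost 𝓦 (Path.Homotopic.Quotient.trans (.mk p) c) (n + 1)

namespace HasCost

variable {Y Z : Type*} [TopologicalSpace Y] [TopologicalSpace Z] {𝓦 : Set (Set Y)} {x y z : Y}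

theorem single (p : Path x y) {W : Set Y} (hW : W ∈ 𝓦) (hp : ∀ t, p t ∈ W) :
    HasCost 𝓦 (.mk p) 1 := by
  simpa using HasCost.cons p _ 0 W hW hp (HasCost.nil y)

theorem trans {c : PathClass x y} {m : ℕ} (hc : HasCost 𝓦 c m) :
    ∀ {z : Y} {d : PathClass y z} {n : ℕ}, HasCost 𝓦 d n → HasCost 𝓦 (c.trans d) (m + n) := by
  induction hc with
  | nil x => intro z d n hd; simpa using hd
  | cons p c m W hW hp hc ih =>
    intro z d n hd
    have := HasCost.cons p _ _ W hW hp (ih hd)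
    rw [Path.Homotopic.Quotient.trans_assoc]
    convert this using 1
    omega

theorem symm {c : PathClass x y} {m : ℕ} (hc : HasCost 𝓦 c m) : HasCost 𝓦 c.symm m := by
  induction hc with
  | nil x => exact HasCost.nil x
  | cons p c m W hW hp hc ih =>
    rw [PathClass.symm_trans_rev]
    exact ih.trans (HasCost.single p.symm hW fun t => hp _)

theorem exists_split : ∀ (m : ℕ) {n : ℕ} {x y : Y} {c : PathClass x y}, HasCost 𝓦 c (m + n) →
    ∃ (z : Y) (c₁ : PathClass x z) (c₂ : PathClass z y), c = c₁.trans c₂ ∧ HasCost 𝓦 c₁ m ∧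
      HasCost 𝓦 c₂ n := by
  intro m
  induction m with
  | zero =>
    intro n x y c hc
    rw [zero_add] at hc
    exact ⟨x, _, c, (Path.Homotopic.Quotient.refl_trans c).symm, HasCost.nil x, hc⟩
  | succ m ih =>
    intro n x y c hc
    obtain ⟨k, hk⟩ : ∃ k, k = m + 1 + n := ⟨_, rfl⟩
    rw [← hk] at hc
    cases hc with
    | nil => omega
    | cons p c k W hW hp hc =>
      obtain rfl : k = m + n := by omega
      obtain ⟨z, c₁, c₂, rfl, h₁, h₂⟩ := ih hc
      exact ⟨z, _, c₂, (Path.Homotopic.Quotient.trans_assoc _ _ _).symm,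
        HasCost.cons p c₁ m W hW hp h₁, h₂⟩

/-- Every path has a finite cost with respect to an open cover. -/
theorem exists_of_isOpen_cover (hO : ∀ W ∈ 𝓦, IsOpen W) (hcov : ⋃₀ 𝓦 = univ)
    (c : PathClass x y) : ∃ n, HasCost 𝓦 c n := by
  induction c using Path.Homotopic.Quotient.ind with | mk p =>
  obtain ⟨t, ht0, hmono, ⟨N, hN⟩, ht⟩ := exists_monotone_Icc_subset_open_cover_unitInterval
    (c := fun W : 𝓦 => p ⁻¹' W.1) (fun W => (hO _ W.2).preimage p.continuous) (by
      intro s _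
      obtain ⟨W, hW, hs⟩ : p s ∈ ⋃₀ 𝓦 := hcov ▸ mem_univ _
      exact mem_iUnion.2 ⟨⟨W, hW⟩, hs⟩)
  have key : ∀ k, ∃ n, HasCost 𝓦 (.mk (p.subpath (t 0) (t k))) n := by
    intro k
    induction k with
    | zero => rw [Path.subpath_self]; exact ⟨0, HasCost.nil _⟩
    | succ k ih =>
      obtain ⟨n, hn⟩ := ih
      obtain ⟨W, hW⟩ := ht k
      have h1 : HasCost 𝓦 (.mk (p.subpath (t k) (t (k + 1)))) 1 := by
        have hle : t k ≤ t (k + 1) := hmono (Nat.le_succ k)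
        refine HasCost.single _ W.2 fun s => ?_
        have hs : p.subpath (t k) (t (k + 1)) s ∈ p '' Icc (t k) (t (k + 1)) := by
          rw [← Path.range_subpath_of_le p _ _ hle]
          exact mem_range_self s
        obtain ⟨r, hr, hrs⟩ := hs
        rw [← hrs]
        exact hW hr
      have := hn.trans h1
      rw [← Path.Homotopic.Quotient.mk_trans] at this
      rw [← Path.Homotopic.Quotient.eq.2 ⟨Path.Homotopy.subpathTransSubpath p (t 0) (t k) (t (k + 1))⟩]
      exact ⟨_, this⟩
  obtain ⟨n, hn⟩ := key N
  rw [ht0, hN N le_rfl, Path.subpath_zero_one] at hn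
  refine ⟨n, ?_⟩
  have aux : ∀ {a b : Y} (ha : a = x) (hb : b = y), HasCost 𝓦 (.mk (p.cast ha hb)) n →
      HasCost 𝓦 (.mk p) n := by
    rintro a b rfl rfl h
    exact h
  exact aux _ _ hn

theorem map (f : C(Y, Z)) {𝓥 : Set (Set Z)} (hf : ∀ W ∈ 𝓦, ∃ V ∈ 𝓥, MapsTo f W V)
    {c : PathClass x y} {n : ℕ} (hc : HasCost 𝓦 c n) : HasCost 𝓥 (c.map f) n := by
  induction hc with
  | nil x => exact HasCost.nil _
  | cons p c n W hW hp hc ih =>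
    obtain ⟨V, hV, h⟩ := hf W hW
    rw [PathClass.map_trans]
    exact HasCost.cons (p.map f.continuous) _ n V hV (fun t => h (hp t)) ih

/-- The cost does not increase if paths in members of `𝓦` are known to run in members of `𝓥`. -/
theorem of_path {𝓥 : Set (Set Y)}
    (h : ∀ W ∈ 𝓦, ∀ {x y : Y} (p : Path x y), (∀ t, p t ∈ W) → ∃ V ∈ 𝓥, ∀ t, p t ∈ V)
    {c : PathClass x y} {n : ℕ} (hc : HasCost 𝓦 c n) : HasCost 𝓥 c n := by
  induction hc with
  | nil x => exact HasCost.nil _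
  | cons p c n W hW hp hc ih =>
    obtain ⟨V, hV, h⟩ := h W hW p hp
    exact HasCost.cons p _ n V hV h ih

/-- Path classes lift through a covering map without a change of cost. -/
theorem exists_lift {E : Type*} [TopologicalSpace E] {f : C(E, Y)} (cov : IsCoveringMap f)
    {c : PathClass x y} {n : ℕ} (hc : HasCost 𝓦 c n) : ∀ {e : E} (he : f e = x),
      ∃ (e' : E) (he' : f e' = y) (c' : PathClass e e'), c'.map f = c.cast he he' ∧
        HasCost (preimage f '' 𝓦) c' n := by
  induction hc with
  | nil x => rintro e rfl; exact ⟨e, rfl, _, rfl, HasCost.nil e⟩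
  | @cons x y z p c n W hW hp hc ih =>
    rintro e rfl
    obtain ⟨e₁, q, rfl, hq⟩ := cov.exists_path_lift p
    obtain ⟨e', rfl, c', hc', hcost⟩ := ih rfl
    refine ⟨e', rfl, Path.Homotopic.Quotient.trans (.mk q) c', ?_, HasCost.cons q c' n _ ⟨W, hW, rfl⟩ (fun t => ?_) hcost⟩
    · rw [PathClass.map_trans, hc']
      have : q.map f.continuous = p := Path.ext (funext hq)
      rw [← this, Path.Homotopic.Quotient.mk_map, Path.Homotopic.Quotient.cast_rfl_rfl,
        Path.Homotopic.Quotient.cast_rfl_rfl]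
    · rw [mem_preimage, hq]
      exact hp t

end HasCost

/-- The sets of diameter less than `ε` (in the sense that all distances are less than `ε`). -/
def smallSubsets (Y : Type*) [PseudoMetricSpace Y] (ε : ℝ) : Set (Set Y) :=
  {W | ∀ a ∈ W, ∀ b ∈ W, dist a b < ε}

section Small

variable {Y : Type*} [PseudoMetricSpace Y] {ε : ℝ} {x y : Y} {c : PathClass x y} {n : ℕ}

/-- A class of cost `n` is represented by a path which stays within `n * ε` of its origin. -/
theorem HasCost.exists_path_dist_le (hc : HasCost (smallSubsets Y ε) c n) :
    ∃ p : Path x y, Path.Homotopic.Quotient.mk p = c ∧ ∀ t, dist (p t) x ≤ n * ε := by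
  induction hc with
  | nil x => exact ⟨Path.refl x, rfl, by simp⟩
  | @cons x y z p c n W hW hp hc ih =>
    obtain ⟨q, rfl, hq⟩ := ih
    refine ⟨p.trans q, rfl, fun t => ?_⟩
    have hpε : ∀ s, dist (p s) x < ε := fun s => by
      simpa using hW _ (hp s) _ (hp 0)
    have hε : 0 < ε := dist_nonneg.trans_lt (hpε 0)
    have : (p.trans q) t ∈ range p ∪ range q := by
      rw [← Path.trans_range]; exact mem_range_self t
    push_cast
    rcases this with ⟨s, hs⟩ | ⟨s, hs⟩
    · rw [← hs]
      nlinarith [hpε s, (Nat.cast_nonneg n : (0 : ℝ) ≤ n)]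
    · rw [← hs]
      have h1 := hq s
      have h2 := hpε 1
      rw [p.target] at h2
      linarith [dist_triangle (q s) y x]

/-- Consecutive small paths can be collected in groups of `M`. -/
theorem HasCost.coarsen (hε : 0 < ε) {M : ℕ} (hM : 0 < M) (hc : HasCost (smallSubsets Y ε) c n) :
    HasCost (smallSubsets Y (3 * M * ε)) c (n / M + 1) := by
  have hM' : (0 : ℝ) < M := by exact_mod_cast hM
  -- up to `M` small paths stay within `M * ε` of their origin, so that any two points on them are
  -- at distance at most `2 * M * ε`
  have key : ∀ {k : ℕ} {x y : Y} {c : PathClass x y}, k ≤ M → HasCost (smallSubsets Y ε) c k →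
      HasCost (smallSubsets Y (3 * M * ε)) c 1 := by
    intro k x y c hk hc
    obtain ⟨p, rfl, hp⟩ := hc.exists_path_dist_le
    refine HasCost.single p (W := range p) ?_ fun t => mem_range_self t
    rintro _ ⟨s, rfl⟩ _ ⟨t, rfl⟩
    have : (k : ℝ) * ε ≤ M * ε := by gcongr
    have h1 := dist_triangle_right (p s) (p t) x
    have : 0 < M * ε := by positivity
    linarith [hp s, hp t]
  induction n using Nat.strong_induction_on generalizing x y with
  | _ n ih =>
    by_cases h : n < M
    · rw [Nat.div_eq_of_lt h]
      exact key h.le hc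
    · push Not at h
      obtain ⟨m, rfl⟩ := Nat.exists_eq_add_of_le h
      obtain ⟨z, c₁, c₂, rfl, h₁, h₂⟩ := hc.exists_split
      have := (key le_rfl h₁).trans (ih m (by omega) h₂)
      rwa [Nat.add_div_left _ hM, add_comm]

end Small

/-! ### Word length and contraction -/

section Word

variable {G : Type*} [Group G] {S : Set G}

theorem wordLength_le {l : List G} (hl : ∀ s ∈ l, s ∈ S ∨ s⁻¹ ∈ S) :
    wordLength S l.prod ≤ l.length :=
  Nat.sInf_le ⟨l, rfl, hl, rfl⟩

/-- The infimum in the definition of the word length is attained. -/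
theorem exists_word (hS : Subgroup.closure S = ⊤) (g : G) :
    ∃ l : List G, l.length = wordLength S g ∧ (∀ s ∈ l, s ∈ S ∨ s⁻¹ ∈ S) ∧ l.prod = g := by
  have hg : g ∈ (Subgroup.closure S).toSubmonoid := hS ▸ Subgroup.mem_top g
  rw [Subgroup.closure_toSubmonoid] at hg
  obtain ⟨l, hl, rfl⟩ := Submonoid.exists_list_of_mem_closure hg
  exact Nat.sInf_mem (s := {n : ℕ | ∃ l' : List G, l'.length = n ∧ (∀ s ∈ l', s ∈ S ∨ s⁻¹ ∈ S) ∧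
    l'.prod = l.prod}) ⟨_, l, rfl, hl, rfl⟩

theorem wordLength_mul_le (hS : Subgroup.closure S = ⊤) (g h : G) :
    wordLength S (g * h) ≤ wordLength S g + wordLength S h := by
  obtain ⟨l, hl, hlS, rfl⟩ := exists_word hS g
  obtain ⟨k, hk, hkS, rfl⟩ := exists_word hS h
  rw [← hl, ← hk, ← List.prod_append, ← List.length_append]
  exact wordLength_le fun s hs => (List.mem_append.1 hs).elim (hlS s) (hkS s)

theorem wordLength_prod_le (hS : Subgroup.closure S = ⊤) {C : ℕ} (l : List G)
    (hl : ∀ s ∈ l, wordLength S s ≤ C) : wordLength S l.prod ≤ C * l.length := by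
  induction l with
  | nil => simpa using wordLength_le (S := S) (l := []) (by simp)
  | cons a l ih =>
    rw [List.prod_cons, List.length_cons, Nat.mul_succ]
    have h1 := wordLength_mul_le hS a l.prod
    have h2 := ih fun s hs => hl s (List.mem_cons_of_mem _ hs)
    have h3 := hl a List.mem_cons_self
    omega

end Word

section Contracting

variable {G : Type*} [Group G] {H : Subgroup G} {φ : H →* G} {S : Set G}

theorem extendByOne_of_mem {g : G} (hg : g ∈ H) : extendByOne φ g = φ ⟨g, hg⟩ := dif_pos hg

theorem mem_iterateDomain_add (m n : ℕ) (g : G) : g ∈ iterateDomain φ (m + n) ↔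
    g ∈ iterateDomain φ m ∧ (extendByOne φ)^[m] g ∈ iterateDomain φ n := by
  induction m generalizing g with
  | zero => simp [iterateDomain]
  | succ m ih =>
    rw [Nat.add_right_comm]
    simp only [iterateDomain, mem_ofPred_eq, ih, Function.iterate_succ_apply]
    constructor
    · rintro ⟨hg, h1, h2⟩
      exact ⟨⟨hg, h1⟩, by rwa [extendByOne_of_mem hg]⟩
    · rintro ⟨⟨hg, h1⟩, h2⟩
      exact ⟨hg, h1, by rwa [extendByOne_of_mem hg] at h2⟩

/-- Iterating a contraction by the factor `1/2`, up to additive constants. -/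
theorem exists_wordLength_iterate_le {N : ℕ}
    (h : ∀ n ≥ N, ∃ B : ℕ, ∀ g ∈ iterateDomain φ n,
      2 * wordLength S ((extendByOne φ)^[n] g) ≤ wordLength S g + B) (k : ℕ) :
    ∀ n ≥ (k + 1) * N, ∃ B : ℕ, ∀ g ∈ iterateDomain φ n,
      2 ^ (k + 1) * wordLength S ((extendByOne φ)^[n] g) ≤ wordLength S g + B := by
  induction k with
  | zero => intro n hn; simpa using h n (by simpa using hn)
  | succ k ih =>
    intro n hn
    have hk : (k + 1 + 1) * N = (k + 1) * N + N := by ring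
    obtain ⟨m, rfl⟩ : ∃ m, n = N + m := Nat.exists_eq_add_of_le (by rw [hk] at hn; omega)
    obtain ⟨B, hB⟩ := h N le_rfl
    obtain ⟨B', hB'⟩ := ih m (by rw [hk] at hn; omega)
    refine ⟨B + 2 * B', fun g hg => ?_⟩
    obtain ⟨h1, h2⟩ := (mem_iterateDomain_add N m g).1 hg
    have h3 := hB g h1
    have h4 := hB' _ h2
    rw [add_comm N m, Function.iterate_add_apply, pow_succ]
    linarith

/-- If all iterates from the `N`-th on contract by the factor `1/2`, up to additive constants, then
the contraction ratio is at most `2 ^ (-1 / (2 * N))`. -/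
theorem contractionRatio_lt_one {N : ℕ}
    (h : ∀ n ≥ N, ∃ B : ℕ, ∀ g ∈ iterateDomain φ n,
      2 * wordLength S ((extendByOne φ)^[n] g) ≤ wordLength S g + B) :
    contractionRatio S φ < 1 := by
  wlog hN : 0 < N generalizing N
  · exact this (N := 1) (fun n hn => h n (by omega)) one_pos
  set a : ℕ → ℝ≥0∞ := fun n => limsup (fun g : G =>
    (wordLength S ((extendByOne φ)^[n] g) : ℝ≥0∞) / (wordLength S g : ℝ≥0∞))
      (comap (wordLength S) atTop ⊓ 𝓟 (iterateDomain φ n)) with ha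
  have hle : ∀ k n, (k + 1) * N ≤ n → a n ≤ (2⁻¹ : ℝ≥0∞) ^ k := by
    intro k n hn
    obtain ⟨B, hB⟩ := exists_wordLength_iterate_le h k n hn
    refine limsup_le_of_le (by isBoundedDefault) ?_
    have h1 : ∀ᶠ g in comap (wordLength S) atTop, B + 1 ≤ wordLength S g :=
      tendsto_comap.eventually (eventually_ge_atTop (B + 1))
    rw [eventually_inf_principal]
    filter_upwards [h1] with g hg1 hg2
    have hg3 := hB g hg2
    have hpos : (wordLength S g : ℝ≥0∞) ≠ 0 := by
      simp only [ne_eq, Nat.cast_eq_zero]; omega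
    rw [ENNReal.div_le_iff hpos (ENNReal.natCast_ne_top _), ← ENNReal.inv_pow, mul_comm,
      ← div_eq_mul_inv, ENNReal.le_div_iff_mul_le (by simp) (by simp)]
    have : wordLength S ((extendByOne φ)^[n] g) * 2 ^ k ≤ wordLength S g := by
      rw [pow_succ] at hg3
      nlinarith
    exact_mod_cast this
  -- for `n ≥ 6 * N` the exponent `k = n / N - 2` satisfies `k / n ≥ 1 / (2 * N)`
  have hev : ∀ᶠ n : ℕ in atTop, a n ^ (1 / (n : ℝ)) ≤ (2⁻¹ : ℝ≥0∞) ^ (1 / (2 * N : ℝ)) := by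
    filter_upwards [eventually_ge_atTop (6 * N)] with n hn
    have hn0 : (0 : ℝ) < n := by exact_mod_cast (by omega : 0 < n)
    have hN0 : (0 : ℝ) < N := by exact_mod_cast hN
    obtain ⟨k, hk⟩ : ∃ k, n / N = k + 2 :=
      Nat.exists_eq_add_of_le' (by rw [Nat.le_div_iff_mul_le hN]; omega)
    have hk1 : (k + 1) * N ≤ n := by
      calc (k + 1) * N ≤ (n / N) * N := Nat.mul_le_mul_right _ (by omega)
        _ ≤ n := Nat.div_mul_le_self n N
    have hk2 : n ≤ (k + 3) * N := by
      have := Nat.lt_div_mul_add hN (a := n)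
      rw [hk] at this
      nlinarith
    calc a n ^ (1 / (n : ℝ)) ≤ ((2⁻¹ : ℝ≥0∞) ^ k) ^ (1 / (n : ℝ)) :=
          ENNReal.rpow_le_rpow (hle k n hk1) (by positivity)
      _ = (2⁻¹ : ℝ≥0∞) ^ (k * (1 / n) : ℝ) := by
          rw [← ENNReal.rpow_natCast, ← ENNReal.rpow_mul]
      _ ≤ _ := by
          refine ENNReal.rpow_le_rpow_of_exponent_ge (by norm_num) ?_
          have h1 : (n : ℝ) ≤ (k + 3) * N := by exact_mod_cast hk2
          have h2 : (6 : ℝ) * N ≤ n := by exact_mod_cast hn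
          rw [mul_one_div, div_le_div_iff₀ (by positivity) hn0]
          nlinarith
  calc contractionRatio S φ ≤ (2⁻¹ : ℝ≥0∞) ^ (1 / (2 * N : ℝ)) :=
        limsup_le_of_le (by isBoundedDefault) hev
    _ < 1 := ENNReal.rpow_lt_one (by norm_num) (by positivity)

end Contracting

/-! ### Loops around a puncture -/

/-- Two paths with the same end points are homotopic if they lift through a continuous map defined
on a convex set to paths with the same end points. -/
theorem Path.homotopic_of_lift {Y : Type*} [TopologicalSpace Y] {L : Set ℂ} (hL : Convex ℝ L)
    (E : C(L, Y)) {x y : Y} {p q : Path x y} {a b : L} (p' q' : Path a b)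
    (hp : ∀ t, E (p' t) = p t) (hq : ∀ t, E (q' t) = q t) : p.Homotopic q := by
  have : ContractibleSpace L := hL.contractibleSpace ⟨a, a.2⟩
  obtain rfl : E a = x := by simpa using hp 0
  obtain rfl : E b = y := by simpa using hp 1
  obtain rfl : p'.map E.continuous = p := Path.ext (funext hp)
  obtain rfl : q'.map E.continuous = q := Path.ext (funext hq)
  exact (SimplyConnectedSpace.paths_homotopic p' q').map E

/-- The straight path between two points of a convex set. -/
def Convex.segmentPath {L : Set ℂ} (hL : Convex ℝ L) (a b : L) : Path a b where
  toFun t := ⟨(1 - t : ℝ) • (a : ℂ) + (t : ℝ) • (b : ℂ), hL a.2 b.2 (by linarith [t.2.2]) t.2.1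
    (by ring)⟩
  continuous_toFun := by fun_prop
  source' := by simp
  target' := by simp

namespace PathClass

variable {Y Z : Type*} [TopologicalSpace Y] [TopologicalSpace Z] {x y z : Y}

/-- Transport of loop classes at `y` to loop classes at `x` along a path class from `x` to `y`. -/
def conj (δ : PathClass x y) : FundamentalGroup Y y →* FundamentalGroup Y x where
  toFun β := δ.trans (Path.Homotopic.Quotient.trans β δ.symm)
  map_one' := by
    change δ.trans (Path.Homotopic.Quotient.trans (Path.Homotopic.Quotient.refl y) δ.symm) =
      Path.Homotopic.Quotient.refl x
    simp
  map_mul' β γ := by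
    change δ.trans (Path.Homotopic.Quotient.trans (Path.Homotopic.Quotient.trans γ β) δ.symm) =
      Path.Homotopic.Quotient.trans (δ.trans (Path.Homotopic.Quotient.trans γ δ.symm))
        (δ.trans (Path.Homotopic.Quotient.trans β δ.symm))
    simp

theorem conj_apply (δ : PathClass x y) (β : FundamentalGroup Y y) :
    conj δ β = δ.trans (Path.Homotopic.Quotient.trans β δ.symm) := rfl

theorem conj_trans (δ : PathClass x y) (ε : PathClass y z) (β : FundamentalGroup Y z) :
    conj (δ.trans ε) β = conj δ (conj ε β) := by
  simp [conj_apply]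

theorem conj_cast {y' : Y} (h : y' = y) (δ : PathClass x y) (β : PathClass y' y') :
    conj (δ.cast rfl h) β = conj δ (β.cast h.symm h.symm) := by
  subst h; simp

theorem map_conj (f : C(Y, Z)) (δ : PathClass x y) (β : FundamentalGroup Y y) :
    FundamentalGroup.map f x (conj δ β) = conj (δ.map f) (FundamentalGroup.map f y β) := by
  change Path.Homotopic.Quotient.map _ f = _
  simp only [conj_apply, map_trans, map_symm]
  rfl

end PathClass

open PathClass in
/-- Peripheral elements, with the connecting path replaced by its homotopy class. -/
theorem isPeripheral_iff {X : Type*} [TopologicalSpace X] {U : Set X} {b : U} {x : X}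
    {g : FundamentalGroup U b} : IsPeripheral x g ↔
      ∀ V ∈ 𝓝 x, ∃ (c : U) (δ : PathClass b c) (β : Path c c), (∀ t, (β t : X) ∈ V) ∧
        g = conj δ (Path.Homotopic.Quotient.mk β) := by
  refine forall₂_congr fun V _ => exists_congr fun c => ⟨?_, ?_⟩
  · rintro ⟨δ, β, hβ, rfl⟩
    refine ⟨.mk δ, β, hβ, ?_⟩
    rw [conj_apply, ← Path.Homotopic.Quotient.mk_symm, ← Path.Homotopic.Quotient.trans_assoc]
    rfl
  · rintro ⟨δ, β, hβ, rfl⟩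
    induction δ using Path.Homotopic.Quotient.ind with | mk δ =>
    refine ⟨δ, β, hβ, ?_⟩
    rw [conj_apply, ← Path.Homotopic.Quotient.mk_symm, ← Path.Homotopic.Quotient.trans_assoc]
    rfl

/-- A coordinate disc centred at a puncture `x` of `U` which contains no other puncture. -/
structure PuncturedDisc {X : Type*} [TopologicalSpace X] (U : Set X) (x : X) where
  /-- the coordinate -/
  chart : OpenPartialHomeomorph X ℂ
  /-- the radius -/
  radius : ℝ
  radius_pos : 0 < radius
  mem_source : x ∈ chart.source
  chart_center : chart x = 0
  ball_subset : Metric.ball 0 radius ⊆ chart.target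
  symm_mem : ∀ z ∈ Metric.ball (0 : ℂ) radius, z ≠ 0 → chart.symm z ∈ U
  center_not_mem : x ∉ U

namespace PuncturedDisc

variable {X : Type*} [TopologicalSpace X] {U : Set X} {x : X} (D : PuncturedDisc U x)

/-- The disc as a neighbourhood of the puncture. -/
def disc : Set X := D.chart.source ∩ D.chart ⁻¹' Metric.ball 0 D.radius

theorem isOpen_disc : IsOpen D.disc :=
  D.chart.isOpen_inter_preimage Metric.isOpen_ball

theorem disc_mem_nhds : D.disc ∈ 𝓝 x :=
  D.isOpen_disc.mem_nhds ⟨D.mem_source, by simp [D.chart_center, D.radius_pos]⟩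

/-- The half-plane which is the universal covering of the punctured disc. -/
def halfPlane : Set ℂ := {w | w.re < Real.log D.radius}

theorem convex_halfPlane : Convex ℝ D.halfPlane :=
  convex_halfSpace_re_lt _

theorem mem_halfPlane_iff {w : ℂ} : w ∈ D.halfPlane ↔ Complex.exp w ∈ Metric.ball 0 D.radius := by
  rw [mem_ball_zero_iff, Complex.norm_exp, ← Real.lt_log_iff_exp_lt D.radius_pos]
  rfl

/-- The covering of the punctured disc given by the exponential function. -/
def cover : C(D.halfPlane, U) where
  toFun w := ⟨D.chart.symm (Complex.exp w), D.symm_mem _ (D.mem_halfPlane_iff.1 w.2)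
    (Complex.exp_ne_zero _)⟩
  continuous_toFun := by
    refine Continuous.subtype_mk ?_ _
    refine D.chart.symm.continuousOn.comp_continuous (by fun_prop) fun w => ?_
    exact D.ball_subset (D.mem_halfPlane_iff.1 w.2)

theorem coe_cover (w : D.halfPlane) : (D.cover w : X) = D.chart.symm (Complex.exp w) := rfl

theorem chart_cover (w : D.halfPlane) : D.chart (D.cover w) = Complex.exp w :=
  D.chart.right_inv (D.ball_subset (D.mem_halfPlane_iff.1 w.2))

theorem cover_mem_disc (w : D.halfPlane) : (D.cover w : X) ∈ D.disc := by
  refine ⟨D.chart.map_target (D.ball_subset (D.mem_halfPlane_iff.1 w.2)), ?_⟩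
  rw [mem_preimage, chart_cover]
  exact D.mem_halfPlane_iff.1 w.2

theorem chart_ne_zero {y : U} (hy : (y : X) ∈ D.disc) : D.chart y ≠ 0 := by
  intro h
  rw [← D.chart_center] at h
  exact D.center_not_mem (D.chart.injOn hy.1 D.mem_source h ▸ y.2)

theorem cover_eq {y : U} (hy : (y : X) ∈ D.disc) (w : D.halfPlane)
    (h : Complex.exp w = D.chart y) : D.cover w = y := by
  apply Subtype.ext
  rw [coe_cover, h, D.chart.left_inv hy.1]

theorem exists_cover_eq {y : U} (hy : (y : X) ∈ D.disc) : ∃ w, D.cover w = y := by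
  have h := Complex.exp_log (D.chart_ne_zero hy)
  exact ⟨⟨Complex.log (D.chart y), D.mem_halfPlane_iff.2 (by rw [h]; exact hy.2)⟩, D.cover_eq hy _ h⟩

/-- The deck transformations `w ↦ w + 2πim`. -/
def shift (a : D.halfPlane) (m : ℤ) : D.halfPlane :=
  ⟨a + m * (2 * Real.pi * Complex.I), by
    have := a.2
    simpa [halfPlane] using this⟩

theorem coe_shift (a : D.halfPlane) (m : ℤ) :
    (D.shift a m : ℂ) = a + m * (2 * Real.pi * Complex.I) := rfl

theorem cover_eq_cover {a b : D.halfPlane} (m : ℤ)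
    (h : (b : ℂ) = a + m * (2 * Real.pi * Complex.I)) : D.cover b = D.cover a := by
  apply Subtype.ext
  rw [coe_cover, coe_cover, Complex.exp_eq_exp_iff_exists_int.2 ⟨m, h⟩]

theorem exists_shift_eq {a b : D.halfPlane} (h : D.cover b = D.cover a) : ∃ m, b = D.shift a m := by
  have := congr_arg D.chart (congr_arg Subtype.val h)
  rw [chart_cover, chart_cover, Complex.exp_eq_exp_iff_exists_int] at this
  obtain ⟨m, hm⟩ := this
  exact ⟨m, Subtype.ext hm⟩

/-- Paths in the punctured disc lift to the half-plane. -/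
theorem exists_lift {a : D.halfPlane} {y : U} (p : Path (D.cover a) y)
    (hp : ∀ t, (p t : X) ∈ D.disc) :
    ∃ (b : D.halfPlane) (p' : Path a b), ∀ t, D.cover (p' t) = p t := by
  let q : C(unitInterval, {z : ℂ // z ≠ 0}) :=
    ⟨fun t => ⟨D.chart (p t), D.chart_ne_zero (hp t)⟩, Continuous.subtype_mk
      (D.chart.continuousOn.comp_continuous (by fun_prop) fun t => (hp t).1) _⟩
  have hq : q 0 = (⟨_, Complex.exp_ne_zero (a : ℂ)⟩ : {z : ℂ // z ≠ 0}) := by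
    apply Subtype.ext
    change D.chart (p 0) = _
    rw [p.source, chart_cover]
  let w := Complex.isCoveringMap_exp.liftPath q a hq
  have hw : ∀ t, Complex.exp (w t) = D.chart (p t) := fun t =>
    congr_arg Subtype.val (congr_fun (Complex.isCoveringMap_exp.liftPath_lifts q a hq) t)
  have hmem : ∀ t, w t ∈ D.halfPlane := fun t => D.mem_halfPlane_iff.2 (hw t ▸ (hp t).2)
  refine ⟨⟨w 1, hmem 1⟩, ⟨⟨fun t => ⟨w t, hmem t⟩, by fun_prop⟩, ?_, rfl⟩, fun t => ?_⟩
  · exact Subtype.ext (Complex.isCoveringMap_exp.liftPath_zero q a hq)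
  · exact D.cover_eq (hp t) _ (hw t)

/-- The loop which runs `m` times around the puncture on a circle. -/
def circle (a : D.halfPlane) (m : ℤ) : Path (D.cover a) (D.cover a) :=
  ((D.convex_halfPlane.segmentPath a (D.shift a m)).map D.cover.continuous).cast rfl
    (D.cover_eq_cover m rfl).symm

theorem circle_apply (a : D.halfPlane) (m : ℤ) (t : unitInterval) :
    D.circle a m t = D.cover (D.convex_halfPlane.segmentPath a (D.shift a m) t) := rfl

/-- The class of `circle`. -/
def circleClass (a : D.halfPlane) (m : ℤ) : FundamentalGroup U (D.cover a) :=
  Path.Homotopic.Quotient.mk (D.circle a m)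

/-- Every loop in the punctured disc is homotopic to some `circle`. -/
theorem exists_circle {c : U} (β : Path c c) (hβ : ∀ t, (β t : X) ∈ D.disc) {a : D.halfPlane}
    (h : D.cover a = c) :
    ∃ m, (Path.Homotopic.Quotient.mk β).cast h h = D.circleClass a m := by
  subst h
  obtain ⟨b, p', hp'⟩ := D.exists_lift β hβ
  obtain ⟨m, rfl⟩ : ∃ m, b = D.shift a m := D.exists_shift_eq (by simpa using hp' 1)
  refine ⟨m, Path.Homotopic.Quotient.eq.2 ?_⟩
  exact Path.homotopic_of_lift D.convex_halfPlane D.cover p' _ hp' fun t => (D.circle_apply a m t).symm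

theorem circleClass_add (a : D.halfPlane) (m n : ℤ) :
    D.circleClass a (n + m) = D.circleClass a m * D.circleClass a n := by
  symm
  refine Path.Homotopic.Quotient.eq.2 ?_
  refine Path.homotopic_of_lift D.convex_halfPlane D.cover
    ((D.convex_halfPlane.segmentPath a (D.shift a n)).trans
      (D.convex_halfPlane.segmentPath (D.shift a n) (D.shift a (n + m))))
    (D.convex_halfPlane.segmentPath a (D.shift a (n + m))) (fun t => ?_) fun t => rfl
  rw [Path.trans_apply, Path.trans_apply]
  split_ifs
  · rfl
  · refine D.cover_eq_cover n ?_
    simp only [Convex.segmentPath, Path.coe_mk_mk, coe_shift, Complex.real_smul]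
    push_cast
    ring

/-- The homomorphism `m ↦ circleClass a m`. -/
def circleHom (a : D.halfPlane) : Multiplicative ℤ →* FundamentalGroup U (D.cover a) :=
  MonoidHom.mk' (fun m => D.circleClass a m.toAdd) fun m n => by
    rw [toAdd_mul, add_comm, circleClass_add]

theorem circleClass_pow (a : D.halfPlane) (m : ℤ) (n : ℕ) :
    D.circleClass a m ^ n = D.circleClass a (n * m) := by
  have := map_pow (D.circleHom a) (Multiplicative.ofAdd m) n
  rw [← ofAdd_nsmul, nsmul_eq_mul] at this
  exact this.symm

theorem circleClass_eq_zpow (a : D.halfPlane) (m : ℤ) :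
    D.circleClass a m = D.circleClass a 1 ^ m := by
  have := map_zpow (D.circleHom a) (Multiplicative.ofAdd 1) m
  rw [← ofAdd_zsmul, zsmul_eq_mul, mul_one] at this
  exact this

/-- The class of the image in the punctured disc of a segment in the half-plane. -/
def segmentClass (a b : D.halfPlane) : PathClass (D.cover a) (D.cover b) :=
  Path.Homotopic.Quotient.map (.mk (D.convex_halfPlane.segmentPath a b)) D.cover

/-- Moving a circle along a path in the punctured disc does not change its free homotopy class. -/
theorem circleClass_eq_conj (a b : D.halfPlane) (m : ℤ) :
    D.circleClass a m = PathClass.conj (D.segmentClass a b) (D.circleClass b m) := by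
  have key : Path.Homotopic.Quotient.trans (D.circleClass a m) (D.segmentClass a b) =
      (D.segmentClass a b).trans (D.circleClass b m) := by
    refine Path.Homotopic.Quotient.eq.2 ?_
    refine Path.homotopic_of_lift D.convex_halfPlane D.cover
      ((D.convex_halfPlane.segmentPath a (D.shift a m)).trans
        (D.convex_halfPlane.segmentPath (D.shift a m) (D.shift b m)))
      ((D.convex_halfPlane.segmentPath a b).trans
        (D.convex_halfPlane.segmentPath b (D.shift b m))) (fun t => ?_) fun t => ?_
    · rw [Path.trans_apply, Path.trans_apply]
      split_ifs
      · rfl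
      · refine D.cover_eq_cover m ?_
        simp only [Convex.segmentPath, Path.coe_mk_mk, coe_shift, Complex.real_smul]
        push_cast
        ring
    · rw [Path.trans_apply, Path.trans_apply]
      split_ifs <;> rfl
  rw [PathClass.conj_apply, ← Path.Homotopic.Quotient.trans_assoc, ← key]
  simp

theorem exists_small_circle {V : Set X} (hV : V ∈ 𝓝 x) :
    ∃ b : D.halfPlane, ∀ (m : ℤ) (t : unitInterval), (D.circle b m t : X) ∈ V := by
  have h0 : D.chart.symm 0 = x := by
    rw [← D.chart_center, D.chart.left_inv D.mem_source]
  have hc : ContinuousAt D.chart.symm 0 :=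
    D.chart.symm.continuousAt (D.ball_subset (by simp [D.radius_pos]))
  obtain ⟨s, hs, hsV⟩ := Metric.mem_nhds_iff.1 (hc.preimage_mem_nhds (h0.symm ▸ hV))
  set ρ := min s D.radius / 2 with hρ
  have hρ0 : 0 < ρ := by have := D.radius_pos; positivity
  have hρs : ρ < s := by
    have := min_le_left s D.radius
    have := lt_min hs D.radius_pos
    linarith
  have hρr : ρ < D.radius := by
    have := min_le_right s D.radius
    have := lt_min hs D.radius_pos
    linarith
  refine ⟨⟨(Real.log ρ : ℂ), ?_⟩, fun m t => hsV ?_⟩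
  · change (Real.log ρ : ℂ).re < _
    rw [Complex.ofReal_re]
    exact Real.log_lt_log hρ0 hρr
  · rw [mem_ball_zero_iff, Complex.norm_exp]
    have key : ∀ a : D.halfPlane, ((D.convex_halfPlane.segmentPath a (D.shift a m) t :
        D.halfPlane) : ℂ).re = (a : ℂ).re := by
      intro a
      simp only [Convex.segmentPath, Path.coe_mk_mk, coe_shift, Complex.real_smul]
      simp
      ring
    rw [key, Complex.ofReal_re, Real.exp_log hρ0]
    exact hρs

theorem isPeripheral_conj_circleClass {b : U} {a : D.halfPlane} (δ : PathClass b (D.cover a))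
    (m : ℤ) : IsPeripheral x (PathClass.conj δ (D.circleClass a m)) := by
  rw [isPeripheral_iff]
  intro V hV
  obtain ⟨a', ha'⟩ := D.exists_small_circle hV
  refine ⟨_, δ.trans (D.segmentClass a a'), D.circle a' m, ha' m, ?_⟩
  rw [PathClass.conj_trans, D.circleClass_eq_conj a a']
  rfl

end PuncturedDisc

/-! ### Local degrees -/

theorem Complex.encard_setOf_pow_eq {k : ℕ} (hk : 1 ≤ k) {ζ : ℂ} (hζ : ζ ≠ 0) :
    {w : ℂ | w ^ k = ζ}.encard = k := by
  have hprim := Complex.isPrimitiveRoot_exp k (by omega)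
  obtain ⟨w, hw⟩ := IsAlgClosed.exists_pow_nat_eq ζ (by omega : 0 < k)
  have h1 : {w : ℂ | w ^ k = ζ} = ((Polynomial.nthRoots k ζ).toFinset : Set ℂ) := by
    ext w
    simp [Polynomial.mem_nthRoots (by omega : 0 < k)]
  rw [h1, Set.encard_coe_eq_coe_finsetCard, Multiset.toFinset_card_of_nodup
    (hprim.nthRoots_nodup hζ), hprim.card_nthRoots, if_pos ⟨w, hw⟩]

section LocalDegree

variable {X : Type*} [TopologicalSpace X] {f g : X → X} {x : X} {k l : ℕ}

/-- The map `f` is `k`-to-one near `x`, except over `f x`: the point `x` has arbitrarily small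
neighbourhoods `W`, with image a neighbourhood of `f x`, such that `x` is the only preimage of `f x`
in `W` and all other points of `f '' W` have exactly `k` preimages in `W`. -/
def HasLocalDegree (f : X → X) (x : X) (k : ℕ) : Prop :=
  ∀ V ∈ 𝓝 x, ∃ W ∈ 𝓝 x, W ⊆ V ∧ f '' W ∈ 𝓝 (f x) ∧ (∀ y ∈ W, f y = f x → y = x) ∧
    ∀ z ∈ f '' W, z ≠ f x → (W ∩ f ⁻¹' {z}).encard = k

theorem hasLocalDegree_id (x : X) : HasLocalDegree (id : X → X) x 1 := by
  intro V hV
  refine ⟨V, hV, Subset.rfl, by simpa using hV, fun y _ h => h, fun z hz _ => ?_⟩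
  have : V ∩ id ⁻¹' {z} = {z} := by
    ext y
    simp only [image_id] at hz
    constructor
    · exact fun h => h.2
    · rintro rfl; exact ⟨hz, rfl⟩
  rw [this, encard_singleton, Nat.cast_one]

theorem HasLocalDegree.comp (hgc : HasLocalDegree g (f x) l) (hfc : HasLocalDegree f x k)
    (hf : ContinuousAt f x) : HasLocalDegree (g ∘ f) x (l * k) := by
  intro V hV
  obtain ⟨W, hW, hWV, hfW, hWx, hWk⟩ := hfc V hV
  obtain ⟨W', hW', hWV', hgW', hWx', hWk'⟩ := hgc _ hfW
  have him : f '' (W ∩ f ⁻¹' W') = W' := by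
    ext y
    constructor
    · rintro ⟨w, ⟨_, h⟩, rfl⟩; exact h
    · intro hy
      obtain ⟨w, hw, rfl⟩ := hWV' hy
      exact ⟨w, ⟨hw, hy⟩, rfl⟩
  refine ⟨W ∩ f ⁻¹' W', inter_mem hW (hf.preimage_mem_nhds hW'), inter_subset_left.trans hWV,
    ?_, ?_, ?_⟩
  · rw [image_comp, him]; exact hgW'
  · rintro y ⟨hy, hy'⟩ h
    exact hWx y hy (hWx' _ hy' h)
  · intro z hz hzx
    rw [image_comp, him] at hz
    have hk' := hWk' z hz hzx
    set T := W' ∩ g ⁻¹' {z} with hT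
    have hTfin : T.Finite := finite_of_encard_eq_coe hk'
    have hunion : (W ∩ f ⁻¹' W') ∩ (g ∘ f) ⁻¹' {z} = ⋃ y ∈ T, W ∩ f ⁻¹' {y} := by
      ext w
      simp only [mem_inter_iff, mem_preimage, mem_iUnion, mem_singleton_iff, hT,
        Function.comp_apply, exists_prop]
      constructor
      · rintro ⟨⟨h1, h2⟩, h3⟩; exact ⟨f w, ⟨h2, h3⟩, h1, rfl⟩
      · rintro ⟨y, ⟨h2, h3⟩, h1, rfl⟩; exact ⟨⟨h1, h2⟩, h3⟩
    have hcard : ∀ y ∈ T, (W ∩ f ⁻¹' {y}).encard = k := fun y hy =>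
      hWk y (hWV' hy.1) fun h => hzx (by rw [← hy.2, h]; rfl)
    have aux : ∀ s : Finset X, (s : Set X) ⊆ T →
        (⋃ y ∈ s, W ∩ f ⁻¹' {y}).encard = (s.card * k : ℕ) := by
      classical
      intro s
      induction s using Finset.induction_on with
      | empty => simp
      | insert a s ha ih =>
        intro hs
        rw [Finset.coe_insert, insert_subset_iff] at hs
        rw [Finset.set_biUnion_insert, encard_union_eq, ih hs.2, hcard a hs.1,
          Finset.card_insert_of_notMem ha, ← Nat.cast_add]
        · congr 1; ring
        · rw [disjoint_iUnion₂_right]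
          intro y hy
          refine disjoint_left.2 ?_
          rintro w ⟨_, h1⟩ ⟨_, h2⟩
          exact ha ((h1.symm.trans h2 : a = y) ▸ hy)
    have := aux hTfin.toFinset (by simp)
    rw [hunion]
    simp only [Finite.mem_toFinset] at this
    rw [this]
    congr 2
    have h2 := hTfin.encard_eq_coe_toFinset_card
    rw [hk'] at h2
    exact_mod_cast h2.symm

/-- The topological local degree agrees with the number of preimages. -/
theorem HasLocalDegree.localDegree_eq (hne : (𝓝[≠] (f x)).NeBot) (hk : 1 ≤ k)
    (h : HasLocalDegree f x k) : localDegree f x = k := by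
  have : (⨅ W ∈ 𝓝 x, ⨆ y : X, (W ∩ f ⁻¹' {y}).encard : ℕ∞) = k := by
    apply le_antisymm
    · obtain ⟨W, hW, -, -, hWx, hWk⟩ := h univ univ_mem
      refine iInf₂_le_of_le W hW (iSup_le fun y => ?_)
      by_cases hy : y ∈ f '' W
      · by_cases hyx : y = f x
        · subst hyx
          have : W ∩ f ⁻¹' {f x} ⊆ {x} := fun w hw => hWx w hw.1 hw.2
          calc (W ∩ f ⁻¹' {f x}).encard ≤ ({x} : Set X).encard := encard_le_encard this
            _ = ((1 : ℕ) : ℕ∞) := by simp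
            _ ≤ k := by exact_mod_cast hk
        · exact (hWk y hy hyx).le
      · have : W ∩ f ⁻¹' {y} = ∅ := by
          ext w
          simp only [mem_inter_iff, mem_preimage, mem_singleton_iff, mem_empty_iff_false, iff_false]
          exact fun hw => hy ⟨w, hw.1, hw.2⟩
        simp [this]
    · refine le_iInf₂ fun V hV => ?_
      obtain ⟨W, hW, hWV, hfW, hWx, hWk⟩ := h V hV
      obtain ⟨z, hz, hzx⟩ := (accPt_iff_nhds.1 (by
        rw [AccPt, principal_univ, inf_top_eq]; exact hne : AccPt (f x) (𝓟 univ))) _ hfW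
      calc (k : ℕ∞) = (W ∩ f ⁻¹' {z}).encard := (hWk z hz.1 hzx).symm
        _ ≤ (V ∩ f ⁻¹' {z}).encard := encard_le_encard (inter_subset_inter_left _ hWV)
        _ ≤ _ := le_iSup (fun y => (V ∩ f ⁻¹' {y}).encard) z
  rw [localDegree, this]
  rfl

end LocalDegree

/-! ### Branched coverings -/

/-- A chart centred at `x` maps a small coordinate disc into a given neighbourhood of `x`, and its
punctured disc misses a given finite set. -/
theorem OpenPartialHomeomorph.exists_radius {X : Type*} [TopologicalSpace X] [T1Space X]
    (φ : OpenPartialHomeomorph X ℂ) {x : X} (hx : x ∈ φ.source) (h0 : φ x = 0) {V A : Set X}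
    (hV : V ∈ 𝓝 x) (hA : A.Finite) : ∃ r₀ > 0, ∀ r ≤ r₀, Metric.ball (0 : ℂ) r ⊆ φ.target ∧
      ∀ z ∈ Metric.ball (0 : ℂ) r, φ.symm z ∈ V ∧ (z ≠ 0 → φ.symm z ∉ A) := by
  have hx0 : φ.symm 0 = x := by rw [← h0, φ.left_inv hx]
  have h0t : (0 : ℂ) ∈ φ.target := h0 ▸ φ.map_source hx
  have hN : V ∩ (A \ {x})ᶜ ∈ 𝓝 x :=
    inter_mem hV ((hA.sdiff).isClosed.isOpen_compl.mem_nhds fun h => h.2 rfl)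
  have hc : φ.symm ⁻¹' (V ∩ (A \ {x})ᶜ) ∩ φ.target ∈ 𝓝 (0 : ℂ) :=
    inter_mem ((φ.symm.continuousAt h0t).preimage_mem_nhds (hx0.symm ▸ hN))
      (φ.open_target.mem_nhds h0t)
  obtain ⟨r₀, hr₀, hsub⟩ := Metric.mem_nhds_iff.1 hc
  refine ⟨r₀, hr₀, fun r hr => ⟨fun z hz => (hsub (Metric.ball_subset_ball hr hz)).2,
    fun z hz => ⟨(hsub (Metric.ball_subset_ball hr hz)).1.1, fun hz0 hzA => ?_⟩⟩⟩
  refine (hsub (Metric.ball_subset_ball hr hz)).1.2 ⟨hzA, fun h => hz0 ?_⟩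
  rw [← φ.right_inv (hsub (Metric.ball_subset_ball hr hz)).2, mem_singleton_iff.1 h, h0]

namespace IsBranchedCovering

variable {X : Type*} [TopologicalSpace X] {f : X → X}

theorem nhdsNE_neBot [T1Space X] (hf : IsBranchedCovering f) (x : X) : (𝓝[≠] x).NeBot := by
  obtain ⟨k, -, φ, -, hx, -, h0, -⟩ := hf.2 x
  have : AccPt x (𝓟 univ) := by
    rw [accPt_iff_nhds]
    intro V hV
    obtain ⟨r, hr, h⟩ := φ.exists_radius hx h0 hV finite_empty
    have hz : ((r / 2 : ℝ) : ℂ) ∈ Metric.ball (0 : ℂ) r := by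
      rw [mem_ball_zero_iff, Complex.norm_real, Real.norm_of_nonneg (by positivity)]
      linarith
    refine ⟨φ.symm ((r / 2 : ℝ) : ℂ), ⟨((h r le_rfl).2 _ hz).1, mem_univ _⟩, fun heq => ?_⟩
    have := φ.right_inv ((h r le_rfl).1 hz)
    rw [heq, h0] at this
    have : r / 2 = 0 := by exact_mod_cast this.symm
    linarith
  rwa [AccPt, principal_univ, inf_top_eq] at this

theorem hasLocalDegree_of_chart [T1Space X] {x : X} {k : ℕ} (hk : 1 ≤ k)
    {φ ψ : OpenPartialHomeomorph X ℂ} (hx : x ∈ φ.source) (hfx : f x ∈ ψ.source) (h0 : φ x = 0)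
    (h0' : ψ (f x) = 0) (hm : MapsTo f φ.source ψ.source)
    (hpow : ∀ y ∈ φ.source, ψ (f y) = φ y ^ k) : HasLocalDegree f x k := by
  intro V hV
  obtain ⟨r, hr0, h⟩ := φ.exists_radius hx h0 hV finite_empty
  obtain ⟨ht, hs⟩ := h r le_rfl
  set W := φ.source ∩ φ ⁻¹' Metric.ball 0 r with hW
  have hWimg : f '' W = ψ.source ∩ ψ ⁻¹' Metric.ball 0 (r ^ k) := by
    ext z
    constructor
    · rintro ⟨y, ⟨hy, hyr⟩, rfl⟩
      refine ⟨hm hy, ?_⟩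
      rw [mem_preimage, hpow y hy, mem_ball_zero_iff, norm_pow]
      exact pow_lt_pow_left₀ (mem_ball_zero_iff.1 hyr) (norm_nonneg _) (by omega)
    · rintro ⟨hz, hzr⟩
      obtain ⟨w, hw⟩ := IsAlgClosed.exists_pow_nat_eq (ψ z) (by omega : 0 < k)
      have hwr : w ∈ Metric.ball (0 : ℂ) r := by
        rw [mem_preimage, mem_ball_zero_iff, ← hw, norm_pow] at hzr
        rw [mem_ball_zero_iff]
        exact lt_of_pow_lt_pow_left₀ k hr0.le hzr
      have hws := φ.map_target (ht hwr)
      refine ⟨φ.symm w, ⟨hws, by rw [mem_preimage, φ.right_inv (ht hwr)]; exact hwr⟩, ?_⟩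
      refine ψ.injOn (hm hws) hz ?_
      rw [hpow _ hws, φ.right_inv (ht hwr), hw]
  refine ⟨W, (φ.isOpen_inter_preimage Metric.isOpen_ball).mem_nhds ⟨hx, by simp [h0, hr0]⟩,
    fun y hy => ?_, ?_, ?_, ?_⟩
  · rw [← φ.left_inv hy.1]
    exact (hs _ hy.2).1
  · rw [hWimg]
    exact (ψ.isOpen_inter_preimage Metric.isOpen_ball).mem_nhds ⟨hfx, by simp [h0', hr0]⟩
  · intro y hy h
    have := hpow y hy.1
    rw [h, h0'] at this
    exact φ.injOn hy.1 hx (by rw [h0]; exact pow_eq_zero_iff (by omega) |>.1 this.symm)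
  · intro z hz hzx
    rw [hWimg] at hz
    have hz0 : ψ z ≠ 0 := fun h => hzx (ψ.injOn hz.1 hfx (h.trans h0'.symm))
    have hroot : ∀ w : ℂ, w ^ k = ψ z → w ∈ Metric.ball (0 : ℂ) r := by
      intro w hw
      have hzr := hz.2
      rw [mem_preimage, mem_ball_zero_iff, ← hw, norm_pow] at hzr
      rw [mem_ball_zero_iff]
      exact lt_of_pow_lt_pow_left₀ k hr0.le hzr
    have : W ∩ f ⁻¹' {z} = φ.symm '' {w : ℂ | w ^ k = ψ z} := by
      ext y
      constructor
      · rintro ⟨hy, rfl⟩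
        exact ⟨φ y, (hpow y hy.1).symm, φ.left_inv hy.1⟩
      · rintro ⟨w, hw, rfl⟩
        have hwr := hroot w hw
        have hws := φ.map_target (ht hwr)
        refine ⟨⟨hws, by rw [mem_preimage, φ.right_inv (ht hwr)]; exact hwr⟩, ?_⟩
        refine ψ.injOn (hm hws) hz.1 ?_
        rw [hpow _ hws, φ.right_inv (ht hwr)]
        exact hw
    rw [this, InjOn.encard_image, Complex.encard_setOf_pow_eq hk hz0]
    exact φ.symm.injOn.mono fun w hw => ht (hroot w hw)

theorem exists_hasLocalDegree [T1Space X] (hf : IsBranchedCovering f) (x : X) :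
    ∃ k, 1 ≤ k ∧ HasLocalDegree f x k := by
  obtain ⟨k, hk, φ, ψ, hx, hfx, h0, h0', hm, hpow⟩ := hf.2 x
  exact ⟨k, hk, hasLocalDegree_of_chart hk hx hfx h0 h0' hm hpow⟩

theorem hasLocalDegree_iterate [T1Space X] (hf : IsBranchedCovering f) (n : ℕ) (x : X) :
    1 ≤ localDegree f^[n] x ∧ HasLocalDegree f^[n] x (localDegree f^[n] x) := by
  suffices h : ∃ k, 1 ≤ k ∧ HasLocalDegree f^[n] x k by
    obtain ⟨k, hk, h⟩ := h
    rw [h.localDegree_eq (hf.nhdsNE_neBot _) hk]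
    exact ⟨hk, h⟩
  induction n generalizing x with
  | zero => exact ⟨1, le_rfl, hasLocalDegree_id x⟩
  | succ n ih =>
    obtain ⟨k, hk, h⟩ := hf.exists_hasLocalDegree x
    obtain ⟨l, hl, h'⟩ := ih (f x)
    exact ⟨l * k, Nat.mul_pos hl hk, h'.comp h hf.1.continuousAt⟩

theorem one_le_localDegree [T1Space X] (hf : IsBranchedCovering f) (x : X) :
    1 ≤ localDegree f x := (hf.hasLocalDegree_iterate 1 x).1

theorem isOpenMap [T1Space X] (hf : IsBranchedCovering f) : IsOpenMap f := by
  refine isOpenMap_iff_nhds_le.2 fun x => ?_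
  intro V hV
  obtain ⟨k, -, h⟩ := hf.exists_hasLocalDegree x
  obtain ⟨W, hW, hWV, hfW, -⟩ := h _ hV
  exact mem_of_superset hfW (image_subset_iff.2 hWV)

theorem finite_fiber [T1Space X] [CompactSpace X] (hf : IsBranchedCovering f) (y : X) :
    (f ⁻¹' {y}).Finite := by
  have hcl : IsClosed (f ⁻¹' {y}) := isClosed_singleton.preimage hf.1
  refine hcl.isCompact.finite (isDiscrete_iff_forall_mem_exists_isOpen.mpr fun x hx => ?_)
  obtain ⟨k, -, h⟩ := hf.exists_hasLocalDegree x
  obtain ⟨W, hW, -, -, hWx, -⟩ := h _ univ_mem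
  obtain ⟨O, hOW, hO, hxO⟩ := mem_nhds_iff.1 hW
  refine ⟨O, hO, ?_⟩
  ext y'
  constructor
  · rintro ⟨h1, h2⟩
    exact hWx y' (hOW h1) (h2.trans (show f x = y from hx).symm)
  · rintro rfl
    exact ⟨hxO, hx⟩

theorem finite_preimage [T1Space X] [CompactSpace X] (hf : IsBranchedCovering f) {P : Set X}
    (hP : P.Finite) : (f ⁻¹' P).Finite :=
  hP.preimage' fun y _ => hf.finite_fiber y

theorem iterate_isOpenMap [T1Space X] (hf : IsBranchedCovering f) (n : ℕ) : IsOpenMap f^[n] := by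
  induction n with
  | zero => exact IsOpenMap.id
  | succ n ih => exact ih.comp hf.isOpenMap

/-- Branched coverings restrict to coverings over the complement of the postcritical set. -/
theorem isCoveringMap_regularCovering [T2Space X] [CompactSpace X] {f : C(X, X)}
    (hf : IsBranchedCovering f) : IsCoveringMap (regularCovering f) := by
  have h : IsCoveringMapOn f (postcriticalSet f)ᶜ := by
    refine f.continuous.isClosedMap.isCoveringMapOn_of_isLocalHomeomorphOn
      (fun y _ => hf.finite_fiber y) (IsLocalHomeomorphOn.mk f _ fun x hx => ?_)
    obtain ⟨k, hk, φ, ψ, hx', hfx, h0, h0', hm, hpow⟩ := hf.2 x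
    have hdeg := (hasLocalDegree_of_chart hk hx' hfx h0 h0' hm hpow).localDegree_eq
      (hf.nhdsNE_neBot _) hk
    obtain rfl : k = 1 := by
      by_contra hne
      exact hx (mem_iUnion.2 ⟨0, x, by rw [mem_ofPred_eq, hdeg]; omega, rfl⟩)
    refine ⟨φ.trans ψ.symm, ?_, fun y hy => ?_⟩
    · rw [OpenPartialHomeomorph.trans_source]
      refine ⟨hx', ?_⟩
      rw [mem_preimage, h0, ← h0']
      exact ψ.map_source hfx
    · rw [OpenPartialHomeomorph.trans_source] at hy
      rw [OpenPartialHomeomorph.coe_trans, Function.comp_apply, ← pow_one (φ y), ← hpow y hy.1,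
        ψ.left_inv (hm hy.1)]
  exact h.isCoveringMap_restrictPreimage

end IsBranchedCovering

/-! ### Weights -/

section Weight

variable {X : Type*} [TopologicalSpace X] {f : X → X}

/-- A component of the preimage of a connected open set under an open map of a compact surface is
mapped onto that set. -/
theorem image_connectedComponentIn_preimage [T2Space X] [CompactSpace X]
    [LocallyConnectedSpace X] {g : X → X} (hg : Continuous g) (hgo : IsOpenMap g) {U : Set X}
    (hU : IsOpen U) (hUc : IsPreconnected U) {x : X} (hx : g x ∈ U) :
    g '' connectedComponentIn (g ⁻¹' U) x = U := by
  set V := connectedComponentIn (g ⁻¹' U) x with hV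
  have hVsub : V ⊆ g ⁻¹' U := connectedComponentIn_subset _ _
  have hxV : x ∈ V := mem_connectedComponentIn hx
  have hVo : IsOpen V := (hU.preimage hg).connectedComponentIn
  refine Subset.antisymm (image_subset_iff.2 hVsub) ?_
  refine hUc.subset_of_closure_inter_subset (hgo V hVo) ⟨g x, hx, x, hxV, rfl⟩ ?_
  rintro y ⟨hy, hyU⟩
  have hcl : IsClosed (g '' closure V) := hg.isClosedMap _ isClosed_closure
  obtain ⟨v, hv, rfl⟩ := closure_minimal (image_mono subset_closure) hcl hy
  have hconn : IsPreconnected (insert v V) :=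
    (isPreconnected_connectedComponentIn (F := g ⁻¹' U) (x := x)).subset_closure (subset_insert _ _)
      (insert_subset hv subset_closure)
  have := hconn.subset_connectedComponentIn (mem_insert_of_mem v hxV)
    (insert_subset hyU hVsub)
  exact ⟨v, this (mem_insert v V), rfl⟩

/-- The axiom [Degree], for the components of `f⁻ⁿ(U)` with `U ∈ 𝓤₀`, bounds the local degrees of all
iterates. -/
theorem IsTopologicallyCXC.exists_localDegree_le [T2Space X] [CompactSpace X]
    [LocallyConnectedSpace X] (hf : IsTopologicallyCXC f) :
    ∃ p : ℕ, ∀ n x, localDegree f^[n] x ≤ p := by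
  obtain ⟨hbr, -, 𝓤, -, hU, hcov, -, -, p, hp⟩ := hf
  refine ⟨p, fun n x => ?_⟩
  obtain ⟨U, hUm, hx⟩ : f^[n] x ∈ ⋃₀ 𝓤 := hcov ▸ mem_univ _
  obtain ⟨hUo, hUc⟩ := hU U hUm
  have hcont : Continuous f^[n] := hbr.1.iterate n
  set V := connectedComponentIn (f^[n] ⁻¹' U) x with hV
  have himg : f^[n] '' V = U := image_connectedComponentIn_preimage hcont
    (hbr.iterate_isOpenMap n) hUo hUc.isPreconnected hx
  have hU0 : U ∈ pullbackCover f 𝓤 0 := by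
    refine ⟨U, hUm, f^[n] x, hx, ?_⟩
    have : f^[0] ⁻¹' U = U := rfl
    rw [this, hUc.isPreconnected.connectedComponentIn hx]
  have hVn : V ∈ pullbackCover f 𝓤 (0 + n) := by
    rw [zero_add]; exact ⟨U, hUm, x, hx, rfl⟩
  have hVx : V ∈ 𝓝 x := (hUo.preimage hcont).connectedComponentIn.mem_nhds
    (mem_connectedComponentIn hx)
  have hle : (⨅ W ∈ 𝓝 x, ⨆ y : X, (W ∩ f^[n] ⁻¹' {y}).encard : ℕ∞) ≤ p := by
    refine iInf₂_le_of_le V hVx (iSup_le fun y => ?_)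
    by_cases hy : y ∈ U
    · exact hp 0 n U hU0 V hVn himg y hy
    · have : V ∩ f^[n] ⁻¹' {y} = ∅ := by
        ext w
        simp only [mem_inter_iff, mem_preimage, mem_singleton_iff, mem_empty_iff_false, iff_false]
        rintro ⟨hw, rfl⟩
        exact hy (himg ▸ mem_image_of_mem _ hw)
      simp [this]
  exact ENat.toNat_le_of_le_natCast hle

/-- The weights are finite, since the local degrees of the iterates are bounded. -/
theorem weight₀_spec [T1Space X] (hf : IsBranchedCovering f) {p : ℕ}
    (hp : ∀ n x, localDegree f^[n] x ≤ p) (y : X) :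
    0 < weight₀ f y ∧ ∀ (n : ℕ) (x : X), f^[n] x = y → localDegree f^[n] x ∣ weight₀ f y :=
  Nat.sInf_mem (s := {m : ℕ | 0 < m ∧ ∀ (n : ℕ) (x : X), f^[n] x = y → localDegree f^[n] x ∣ m})
    ⟨p.factorial, p.factorial_pos, fun n x _ =>
      Nat.dvd_factorial (hf.hasLocalDegree_iterate n x).1 (hp n x)⟩

/-- The weight divides every common multiple of the local degrees. -/
theorem weight₀_dvd [T1Space X] (hf : IsBranchedCovering f) {p : ℕ}
    (hp : ∀ n x, localDegree f^[n] x ≤ p) {y : X} {m : ℕ}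
    (hm : ∀ (n : ℕ) (x : X), f^[n] x = y → localDegree f^[n] x ∣ m) : weight₀ f y ∣ m := by
  obtain ⟨h0, h⟩ := weight₀_spec hf hp y
  rw [Nat.dvd_iff_mod_eq_zero]
  by_contra hne
  refine absurd (Nat.sInf_le (s := {m : ℕ | 0 < m ∧ ∀ (n : ℕ) (x : X), f^[n] x = y →
    localDegree f^[n] x ∣ m}) (m := m % weight₀ f y) ⟨Nat.pos_of_ne_zero hne, fun n x hx =>
      (Nat.dvd_mod_iff (h n x hx)).2 (hm n x hx)⟩) ?_
  exact not_le.2 (Nat.mod_lt m h0)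

theorem localDegree_mul_weight₁ [T1Space X] (hf : IsBranchedCovering f) {p : ℕ}
    (hp : ∀ n x, localDegree f^[n] x ≤ p) (x : X) :
    localDegree f x * weight₁ f x = weight₀ f (f x) :=
  Nat.mul_div_cancel' ((weight₀_spec hf hp (f x)).2 1 x rfl)

theorem weight₀_dvd_weight₁ [T1Space X] (hf : IsBranchedCovering f) {p : ℕ}
    (hp : ∀ n x, localDegree f^[n] x ≤ p) (x : X) : weight₀ f x ∣ weight₁ f x := by
  refine weight₀_dvd hf hp fun n y hy => ?_
  have h := (weight₀_spec hf hp (f x)).2 (n + 1) y (by rw [Function.iterate_succ_apply', hy])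
  have hcomp : localDegree f^[n + 1] y = localDegree f x * localDegree f^[n] y := by
    rw [Function.iterate_succ', ← hy]
    obtain ⟨hk, h1⟩ := hf.hasLocalDegree_iterate n y
    obtain ⟨hl, h2⟩ := hf.hasLocalDegree_iterate 1 (f^[n] y)
    exact (h2.comp h1 (hf.1.iterate n).continuousAt).localDegree_eq (hf.nhdsNE_neBot _)
      (Nat.mul_pos hl hk)
  rw [hcomp, ← localDegree_mul_weight₁ hf hp] at h
  exact Nat.dvd_of_mul_dvd_mul_left (hf.one_le_localDegree x) h

end Weight

/-! ### Discs around the punctures -/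

section Discs

variable {X : Type*} [TopologicalSpace X] {f : C(X, X)}

theorem not_mem_regularSet₀ {x : X} : x ∉ regularSet₀ f ↔ x ∈ postcriticalSet f := not_not

theorem not_mem_regularSet₁ {x : X} : x ∉ regularSet₁ f ↔ f x ∈ postcriticalSet f := not_not

/-- Around a puncture of `U₁` there are small discs on which `f` is the power map. -/
theorem exists_puncturedDisc_pair [T2Space X] [CompactSpace X] (hf : IsBranchedCovering f)
    (hP : (postcriticalSet f).Finite) {x : X} (hx : f x ∈ postcriticalSet f) {V : Set X}
    (hV : V ∈ 𝓝 x) :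
    ∃ (D' : PuncturedDisc (regularSet₁ f) x) (D : PuncturedDisc (regularSet₀ f) (f x)),
      D'.disc ⊆ V ∧ ∀ w : D'.halfPlane, ∃ w' : D.halfPlane, (w' : ℂ) = localDegree f x * w ∧
        regularCovering f (D'.cover w) = D.cover w' := by
  obtain ⟨k, hk, φ, ψ, hx', hfx, h0, h0', hm, hpow⟩ := hf.2 x
  have hdeg := (IsBranchedCovering.hasLocalDegree_of_chart hk hx' hfx h0 h0' hm hpow).localDegree_eq
    (hf.nhdsNE_neBot _) hk
  obtain ⟨r₀, hr₀, h₀⟩ := φ.exists_radius hx' h0 hV (hf.finite_preimage hP)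
  obtain ⟨r₁, hr₁, h₁⟩ := ψ.exists_radius hfx h0' univ_mem hP
  -- `r ≤ 1` ensures `r ^ k ≤ r ≤ r₁`
  set r := min (min r₀ r₁) 1 with hr
  have hr0 : 0 < r := lt_min (lt_min hr₀ hr₁) one_pos
  have hrk : r ^ k ≤ r₁ :=
    (pow_le_of_le_one hr0.le (min_le_right _ _) (by omega)).trans
      ((min_le_left _ _).trans (min_le_right _ _))
  obtain ⟨ht, hs⟩ := h₀ r ((min_le_left _ _).trans (min_le_left _ _))
  obtain ⟨ht', hs'⟩ := h₁ (r ^ k) hrk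
  let D' : PuncturedDisc (regularSet₁ f) x :=
    { chart := φ, radius := r, radius_pos := hr0, mem_source := hx', chart_center := h0,
      ball_subset := ht, symm_mem := fun z hz hz0 => (hs z hz).2 hz0,
      center_not_mem := not_mem_regularSet₁.2 hx }
  let D : PuncturedDisc (regularSet₀ f) (f x) :=
    { chart := ψ, radius := r ^ k, radius_pos := by positivity, mem_source := hfx,
      chart_center := h0', ball_subset := ht', symm_mem := fun z hz hz0 => (hs' z hz).2 hz0,
      center_not_mem := not_mem_regularSet₀.2 hx }
  refine ⟨D', D, fun y hy => ?_, fun w => ?_⟩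
  · rw [← φ.left_inv hy.1]
    exact (hs _ hy.2).1
  · have hw := D'.mem_halfPlane_iff.1 w.2
    have hmem : (k * w : ℂ) ∈ D.halfPlane := by
      rw [D.mem_halfPlane_iff, Complex.exp_nat_mul, mem_ball_zero_iff, norm_pow]
      exact pow_lt_pow_left₀ (mem_ball_zero_iff.1 hw) (norm_nonneg _) (by omega)
    refine ⟨⟨k * w, hmem⟩, by rw [hdeg], ?_⟩
    have hws : φ.symm (Complex.exp w) ∈ φ.source := φ.map_target (ht hw)
    refine (D.cover_eq ⟨hm hws, ?_⟩ _ ?_).symm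
    · change ψ (f (φ.symm (Complex.exp w))) ∈ Metric.ball (0 : ℂ) D.radius
      rw [hpow _ hws, φ.right_inv (ht hw), ← Complex.exp_nat_mul]
      exact D.mem_halfPlane_iff.1 hmem
    · change Complex.exp (k * w) = ψ (f (φ.symm (Complex.exp w)))
      rw [hpow _ hws, φ.right_inv (ht hw), Complex.exp_nat_mul]

/-- The covering `f` maps a circle traversed `m` times to a circle traversed `m deg(f, x)` times. -/
theorem exists_map_conj_circleClass {x : X} {k : ℕ} {D' : PuncturedDisc (regularSet₁ f) x}
    {D : PuncturedDisc (regularSet₀ f) (f x)} {b : regularSet₁ f} {a : D'.halfPlane}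
    {a' : D.halfPlane} (ha' : (a' : ℂ) = k * a)
    (h : ∀ w : D'.halfPlane, ∃ w' : D.halfPlane, (w' : ℂ) = k * w ∧
        regularCovering f (D'.cover w) = D.cover w')
    (haa' : D.cover a' = regularCovering f (D'.cover a))
    (δ : PathClass b (D'.cover a)) (m : ℤ) :
    FundamentalGroup.map (regularCovering f) b (PathClass.conj δ (D'.circleClass a m)) =
      PathClass.conj ((δ.map (regularCovering f)).cast rfl haa') (D.circleClass a' (k * m)) := by
  rw [PathClass.map_conj, PathClass.conj_cast]
  congr 1
  change Path.Homotopic.Quotient.mk ((D'.circle a m).map (regularCovering f).continuous) =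
    Path.Homotopic.Quotient.mk ((D.circle a' (k * m)).cast haa'.symm haa'.symm)
  congr 1
  ext1
  funext t
  change regularCovering f (D'.circle a m t) = D.circle a' (k * m) t
  rw [D'.circle_apply, D.circle_apply]
  obtain ⟨w', hw', hw⟩ := h (D'.convex_halfPlane.segmentPath a (D'.shift a m) t)
  rw [hw]
  congr 1
  apply Subtype.ext
  rw [hw']
  simp only [Convex.segmentPath, Path.coe_mk_mk, PuncturedDisc.coe_shift, Complex.real_smul, ha']
  push_cast
  ring

end Discs

/-! ### Lifting homotopy classes through a covering -/

section Lifting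

variable {E Y : Type*} [TopologicalSpace E] [TopologicalSpace Y] {f : C(E, Y)} {e e₁ e₂ : E} {y : Y}

theorem IsCoveringMap.exists_class_lift (cov : IsCoveringMap f) (c : PathClass (f e) y) :
    ∃ (e' : E) (h : f e' = y) (c' : PathClass e e'), c'.map f = c.cast rfl h := by
  induction c using Path.Homotopic.Quotient.ind with | mk p =>
  obtain ⟨e', q, rfl, hq⟩ := cov.exists_path_lift p
  refine ⟨e', rfl, .mk q, ?_⟩
  rw [← Path.Homotopic.Quotient.mk_map, Path.Homotopic.Quotient.cast_rfl_rfl]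
  exact congr_arg _ (Path.ext (funext hq))

/-- Lifts of a homotopy class of paths are unique, including their end points. -/
theorem IsCoveringMap.class_lift_unique (cov : IsCoveringMap f) (c₁ : PathClass e e₁)
    (c₂ : PathClass e e₂) (h : f e₁ = f e₂) (hc : c₁.map f = (c₂.map f).cast rfl h) :
    ∃ h' : e₁ = e₂, c₁ = c₂.cast rfl h' := by
  have h1 : cov.monodromy (c₂.map f) ⟨e, rfl⟩ = ⟨e₁, h⟩ :=
    cov.monodromy_eq_of_map_eq (ex := ⟨e, rfl⟩) (ey := ⟨e₁, h⟩) c₁ hc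
  have h2 : cov.monodromy (c₂.map f) ⟨e, rfl⟩ = ⟨e₂, rfl⟩ := cov.monodromy_map c₂
  obtain rfl : e₁ = e₂ := congr_arg Subtype.val (h1.symm.trans h2)
  refine ⟨rfl, ?_⟩
  rw [Path.Homotopic.Quotient.cast_rfl_rfl] at hc ⊢
  exact cov.injective_path_homotopic_map _ _ hc

/-- The image of the fundamental group of a covering with finite fibres has finite index. -/
theorem IsCoveringMap.finiteIndex_range_map (cov : IsCoveringMap f) (e : E)
    (hfin : (f ⁻¹' {f e}).Finite) : (FundamentalGroup.map f e).range.FiniteIndex := by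
  let _ := cov.fundamentalGroupMulAction (f e)
  have : Finite (f ⁻¹' {f e}) := hfin
  have hst : (MulAction.stabilizer (FundamentalGroup Y (f e))
      (⟨e, rfl⟩ : f ⁻¹' {f e})).FiniteIndex := by
    rw [Subgroup.finiteIndex_iff, MulAction.index_stabilizer]
    exact ((ncard_pos (toFinite _)).2 ⟨_, MulAction.mem_orbit_self _⟩).ne'
  refine @Subgroup.finiteIndex_of_le _ _ _ _ hst fun g hg => ?_
  obtain ⟨e', he', c', hc'⟩ := cov.exists_class_lift (e := e) (y := f e) g
  have h1 : cov.monodromy g ⟨e, rfl⟩ = ⟨e', he'⟩ :=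
    cov.monodromy_eq_of_map_eq (ex := ⟨e, rfl⟩) (ey := ⟨e', he'⟩) c' hc'
  have h2 : cov.monodromy g ⟨e, rfl⟩ = ⟨e, rfl⟩ := hg
  obtain rfl : e' = e := congr_arg Subtype.val (h1.symm.trans h2)
  rw [Path.Homotopic.Quotient.cast_rfl_rfl] at hc'
  exact ⟨c', hc'⟩

end Lifting

/-! ### Homomorphisms between orbifold fundamental groups -/

section Kernel

variable {X : Type*} [TopologicalSpace X] {U : Set X} {ν : X → ℕ} {b c : U} {x : X}

theorem IsPeripheral.conj (δ : PathClass b c) {g : FundamentalGroup U c} (hg : IsPeripheral x g) :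
    IsPeripheral x (PathClass.conj δ g) := by
  rw [isPeripheral_iff] at hg ⊢
  intro V hV
  obtain ⟨d, ε, β, hβ, rfl⟩ := hg V hV
  exact ⟨d, δ.trans ε, β, hβ, (PathClass.conj_trans _ _ _).symm⟩

theorem IsPeripheral.pow_mem_orbifoldKernel {g : FundamentalGroup U b} (hg : IsPeripheral x g)
    (hx : x ∉ U) : g ^ ν x ∈ orbifoldKernel U ν b :=
  Subgroup.subset_normalClosure ⟨x, hx, g, hg, rfl⟩

theorem conj_mem_orbifoldKernel (δ : PathClass b c) {g : FundamentalGroup U c}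
    (hg : g ∈ orbifoldKernel U ν c) : PathClass.conj δ g ∈ orbifoldKernel U ν b := by
  suffices h : orbifoldKernel U ν c ≤ (orbifoldKernel U ν b).comap (PathClass.conj δ) from h hg
  refine Subgroup.normalClosure_le_normal ?_
  rintro _ ⟨x, hx, g, hg, rfl⟩
  rw [SetLike.mem_coe, Subgroup.mem_comap, map_pow]
  exact (hg.conj δ).pow_mem_orbifoldKernel hx

/-- It suffices to check the generators `g ^ ν x`, without their conjugates, since conjugates of
peripheral elements are peripheral. -/
theorem orbifoldKernel_le {K : Subgroup (FundamentalGroup U b)}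
    (h : ∀ x ∉ U, ∀ g : FundamentalGroup U b, IsPeripheral x g → g ^ ν x ∈ K) :
    orbifoldKernel U ν b ≤ K := by
  refine (Subgroup.closure_le _).2 fun g' hg' => ?_
  obtain ⟨_, ⟨x, hx, g, hg, rfl⟩, hconj⟩ := Group.mem_conjugatesOfSet_iff.1 hg'
  obtain ⟨c, rfl⟩ := isConj_iff.1 hconj
  have : c * g ^ ν x * c⁻¹ = (PathClass.conj (Path.Homotopic.Quotient.symm c) g) ^ ν x := by
    have h1 : PathClass.conj (Path.Homotopic.Quotient.symm c) g = c * g * c⁻¹ := by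
      change Path.Homotopic.Quotient.trans _ (Path.Homotopic.Quotient.trans g _) =
        Path.Homotopic.Quotient.trans (Path.Homotopic.Quotient.symm c)
          (Path.Homotopic.Quotient.trans g c)
      rw [PathClass.symm_symm]
    rw [h1, conj_pow]
  rw [this]
  exact h x hx _ (hg.conj _)

/-- An element which is peripheral at `x` is, for any disc around `x`, a conjugate of a circle. -/
theorem IsPeripheral.exists_circleClass {g : FundamentalGroup U b} (hg : IsPeripheral x g) (D : PuncturedDisc U x) :
    ∃ (a : D.halfPlane) (δ : PathClass b (D.cover a)) (m : ℤ),
      g = PathClass.conj δ (D.circleClass a m) := by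
  obtain ⟨c, δ, β, hβ, rfl⟩ := isPeripheral_iff.1 hg D.disc D.disc_mem_nhds
  obtain ⟨a, rfl⟩ := D.exists_cover_eq (y := c) (by simpa using hβ 0)
  obtain ⟨m, hm⟩ := D.exists_circle β hβ rfl
  exact ⟨a, δ, m, by rw [← hm, Path.Homotopic.Quotient.cast_rfl_rfl]⟩

end Kernel

section Orbifold

variable {X : Type*} [TopologicalSpace X] [T2Space X] {f : C(X, X)}

/-- A point which is not a puncture has small coordinate discs in `U₀`. -/
theorem exists_disc (hf : IsBranchedCovering f) (hP : (postcriticalSet f).Finite) {x : X}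
    (hx : x ∉ postcriticalSet f) {V : Set X} (hV : V ∈ 𝓝 x) :
    ∃ r > 0, ∃ (E : C(Metric.ball (0 : ℂ) r, regularSet₀ f)), ∃ W ∈ 𝓝 x,
      ∃ s : C(W, Metric.ball (0 : ℂ) r), (∀ w, (E (s w) : X) = w) ∧ ∀ z, (E z : X) ∈ V := by
  obtain ⟨k, -, φ, -, hx', -, h0, -⟩ := hf.2 x
  obtain ⟨r, hr, h⟩ := φ.exists_radius hx' h0 hV hP
  obtain ⟨ht, hs⟩ := h r le_rfl
  have hmem : ∀ z ∈ Metric.ball (0 : ℂ) r, φ.symm z ∈ regularSet₀ f := by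
    intro z hz
    by_cases hz0 : z = 0
    · rw [hz0, ← h0, φ.left_inv hx']; exact hx
    · exact (hs z hz).2 hz0
  exact ⟨r, hr, ⟨fun z => ⟨φ.symm z, hmem z z.2⟩, Continuous.subtype_mk
      (φ.symm.continuousOn.comp_continuous (by fun_prop) fun z => ht z.2) _⟩,
    φ.source ∩ φ ⁻¹' Metric.ball 0 r, (φ.isOpen_inter_preimage Metric.isOpen_ball).mem_nhds
      ⟨hx', by simp [h0, hr]⟩, ⟨fun w => ⟨φ w, w.2.2⟩, Continuous.subtype_mk
      (φ.continuousOn.comp_continuous (by fun_prop) fun w => w.2.1) _⟩,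
    fun w => φ.left_inv w.2.1, fun z => (hs z z.2).1⟩

/-- Small loops in `U₀` around a point which is not a puncture are contractible. -/
theorem exists_nhds_loop_trivial (hf : IsBranchedCovering f) (hP : (postcriticalSet f).Finite)
    {x : X} (hx : x ∉ postcriticalSet f) : ∃ V ∈ 𝓝 x, ∀ (c : regularSet₀ f) (β : Path c c),
      (∀ t, (β t : X) ∈ V) → Path.Homotopic.Quotient.mk β = Path.Homotopic.Quotient.refl c := by
  obtain ⟨r, -, E, W, hW, s, hs, -⟩ := exists_disc hf hP hx univ_mem
  refine ⟨W, hW, fun c β hβ => ?_⟩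
  let β' : Path (s ⟨β 0, hβ 0⟩) (s ⟨β 0, hβ 0⟩) :=
    { toFun := fun t => s ⟨β t, hβ t⟩
      continuous_toFun := by fun_prop
      source' := rfl
      target' := by simp }
  refine Path.Homotopic.Quotient.eq.2 ?_
  refine Path.homotopic_of_lift (convex_ball 0 r) E β' (Path.refl _)
    (fun t => Subtype.ext (hs ⟨β t, hβ t⟩)) fun t => ?_
  rw [Path.refl_apply, Path.refl_apply]
  exact Subtype.ext ((hs _).trans (congr_arg Subtype.val β.source))

variable {p : ℕ} {b₁ : regularSet₁ f}

theorem map_regularCovering_mem_orbifoldKernel [CompactSpace X] (hf : IsBranchedCovering f)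
    (hP : (postcriticalSet f).Finite) (hp : ∀ n x, localDegree f^[n] x ≤ p)
    {g : FundamentalGroup (regularSet₁ f) b₁}
    (hg : g ∈ orbifoldKernel (regularSet₁ f) (weight₁ f) b₁) :
    FundamentalGroup.map (regularCovering f) b₁ g ∈
      orbifoldKernel (regularSet₀ f) (weight₀ f) (regularCovering f b₁) := by
  suffices h : orbifoldKernel (regularSet₁ f) (weight₁ f) b₁ ≤
      (orbifoldKernel (regularSet₀ f) (weight₀ f) (regularCovering f b₁)).comap
        (FundamentalGroup.map (regularCovering f) b₁) from h hg
  refine orbifoldKernel_le fun x hx g hg => ?_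
  have hx' : f x ∈ postcriticalSet f := not_mem_regularSet₁.1 hx
  obtain ⟨D', D, -, h⟩ := exists_puncturedDisc_pair hf hP hx' univ_mem
  obtain ⟨a, δ, m, rfl⟩ := hg.exists_circleClass D'
  obtain ⟨a', ha', haa'⟩ := h a
  rw [Subgroup.mem_comap, map_pow, exists_map_conj_circleClass ha' h haa'.symm]
  rw [← map_pow, D.circleClass_pow]
  have : ((weight₁ f x : ℕ) : ℤ) * (localDegree f x * m) = (weight₀ f (f x) : ℕ) * m := by
    rw [← localDegree_mul_weight₁ hf hp x]; push_cast; ring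
  rw [this, ← D.circleClass_pow, map_pow]
  exact (D.isPeripheral_conj_circleClass _ _).pow_mem_orbifoldKernel D.center_not_mem

theorem map_regularInclusion_mem_orbifoldKernel (hf : IsBranchedCovering f)
    (hP : (postcriticalSet f).Finite) (hp : ∀ n x, localDegree f^[n] x ≤ p)
    {g : FundamentalGroup (regularSet₁ f) b₁}
    (hg : g ∈ orbifoldKernel (regularSet₁ f) (weight₁ f) b₁) :
    FundamentalGroup.map (regularInclusion f) b₁ g ∈
      orbifoldKernel (regularSet₀ f) (weight₀ f) (regularInclusion f b₁) := by
  suffices h : orbifoldKernel (regularSet₁ f) (weight₁ f) b₁ ≤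
      (orbifoldKernel (regularSet₀ f) (weight₀ f) (regularInclusion f b₁)).comap
        (FundamentalGroup.map (regularInclusion f) b₁) from h hg
  refine orbifoldKernel_le fun x hx g hg => ?_
  rw [Subgroup.mem_comap, map_pow]
  by_cases hxP : x ∈ postcriticalSet f
  · obtain ⟨j, hj⟩ := weight₀_dvd_weight₁ hf hp x
    rw [hj, pow_mul]
    refine Subgroup.pow_mem _ (IsPeripheral.pow_mem_orbifoldKernel ?_ (not_mem_regularSet₀.2 hxP)) _
    rw [isPeripheral_iff] at hg ⊢
    intro V hV
    obtain ⟨c, δ, β, hβ, rfl⟩ := hg V hV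
    exact ⟨_, δ.map (regularInclusion f), β.map (regularInclusion f).continuous, hβ,
      PathClass.map_conj _ _ _⟩
  · -- over a point of `f⁻¹(P)` outside of `P` the puncture is filled in
    obtain ⟨V, hV, htriv⟩ := exists_nhds_loop_trivial hf hP hxP
    obtain ⟨c, δ, β, hβ, rfl⟩ := isPeripheral_iff.1 hg V hV
    have : FundamentalGroup.map (regularInclusion f) c (Path.Homotopic.Quotient.mk β) = 1 :=
      htriv _ (β.map (regularInclusion f).continuous) hβ
    rw [PathClass.map_conj, this, map_one, one_pow]
    exact Subgroup.one_mem _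

/-- The kernel of `π₁(U₀) → π₁(𝒪₀)` consists of images of elements of the kernel of
`π₁(U₁) → π₁(𝒪₁)`: the power `ν₀(x)` of a small loop around a puncture `x` lifts to a closed loop
around each preimage of `x`. -/
theorem exists_map_eq_of_mem_orbifoldKernel [CompactSpace X] (hf : IsBranchedCovering f)
    (hP : (postcriticalSet f).Finite) (hp : ∀ n x, localDegree f^[n] x ≤ p)
    {g : FundamentalGroup (regularSet₀ f) (regularCovering f b₁)}
    (hg : g ∈ orbifoldKernel (regularSet₀ f) (weight₀ f) (regularCovering f b₁)) :
    ∃ h ∈ orbifoldKernel (regularSet₁ f) (weight₁ f) b₁,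
      FundamentalGroup.map (regularCovering f) b₁ h = g := by
  suffices h : orbifoldKernel (regularSet₀ f) (weight₀ f) (regularCovering f b₁) ≤
      (orbifoldKernel (regularSet₁ f) (weight₁ f) b₁).map
        (FundamentalGroup.map (regularCovering f) b₁) from h hg
  refine orbifoldKernel_le fun x hx g hg => ?_
  have hxP : x ∈ postcriticalSet f := not_mem_regularSet₀.1 hx
  have hpair := fun y : f ⁻¹' {x} => exists_puncturedDisc_pair hf hP (x := y)
    (by rw [show f y = x from y.2]; exact hxP) univ_mem
  choose D' D _ hD using hpair
  have : Finite (f ⁻¹' {x}) := hf.finite_fiber x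
  -- a neighbourhood of `x` with preimage in the union of the discs around the preimages of `x`
  set V : Set X := (f '' (⋃ y, (D' y).disc)ᶜ)ᶜ ∩ ⋂ y, (D y).disc with hVdef
  have hV : V ∈ 𝓝 x := by
    refine inter_mem (IsOpen.mem_nhds ?_ ?_) (iInter_mem.2 fun y => ?_)
    · exact (f.continuous.isClosedMap _
        (isOpen_iUnion fun y => (D' y).isOpen_disc).isClosed_compl).isOpen_compl
    · rintro ⟨y, hy, hyx⟩
      exact hy (mem_iUnion.2 ⟨⟨y, hyx⟩, mem_of_mem_nhds (D' ⟨y, hyx⟩).disc_mem_nhds⟩)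
    · have := (D y).disc_mem_nhds
      rwa [congr_arg 𝓝 (show f y = x from y.2)] at this
  obtain ⟨c, δ, β, hβ, rfl⟩ := isPeripheral_iff.1 hg V hV
  obtain ⟨e, rfl, δ', hδ'⟩ := (hf.isCoveringMap_regularCovering).exists_class_lift δ
  have he : (e : X) ∈ ⋃ y, (D' y).disc := by
    by_contra hne
    have := (hβ 0).1
    rw [β.source] at this
    exact this ⟨e, hne, rfl⟩
  obtain ⟨y, hy⟩ := mem_iUnion.1 he
  obtain ⟨a, rfl⟩ := (D' y).exists_cover_eq hy
  obtain ⟨a', ha', haa'⟩ := hD y a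
  obtain ⟨m, hm⟩ := (D y).exists_circle β (fun t => mem_iInter.1 (hβ t).2 y) haa'.symm
  refine ⟨PathClass.conj δ' ((D' y).circleClass a m) ^ weight₁ f y,
    ((D' y).isPeripheral_conj_circleClass δ' m).pow_mem_orbifoldKernel (D' y).center_not_mem, ?_⟩
  rw [map_pow, exists_map_conj_circleClass ha' (hD y) haa'.symm, hδ', ← map_pow,
    (D y).circleClass_pow]
  have : ((weight₁ f y : ℕ) : ℤ) * (localDegree f y * m) = (weight₀ f x : ℕ) * m := by
    rw [show weight₀ f x = weight₀ f (f y) by rw [show f y = x from y.2],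
      ← localDegree_mul_weight₁ hf hp y]
    push_cast; ring
  rw [this, ← (D y).circleClass_pow, map_pow, ← hm, PathClass.conj_cast,
    Path.Homotopic.Quotient.cast_rfl_rfl, Path.Homotopic.Quotient.cast_cast,
    Path.Homotopic.Quotient.cast_rfl_rfl]

/-- The virtual endomorphism exists, and is computed by lifting loops: if the loop `d` lifts to the
loop `c` at `b₁`, then `φ` maps the class of `d` to the class of `α⁻¹ c α`. -/
theorem exists_isVirtualEndomorphism [CompactSpace X] (hf : IsBranchedCovering f)
    (hP : (postcriticalSet f).Finite) (hp : ∀ n x, localDegree f^[n] x ≤ p)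
    (α : Path (regularInclusion f b₁) (regularCovering f b₁)) :
    ∃ (H : Subgroup (OrbifoldGroup₀ f (regularCovering f b₁)))
      (φ : H →* OrbifoldGroup₀ f (regularCovering f b₁)),
      H.FiniteIndex ∧ IsVirtualEndomorphism f b₁ α H φ ∧
      ∀ d : FundamentalGroup (regularSet₀ f) (regularCovering f b₁),
        ∀ hd : (QuotientGroup.mk d : OrbifoldGroup₀ f (regularCovering f b₁)) ∈ H,
          ∃ c : PathClass b₁ b₁, c.map (regularCovering f) = d ∧
            φ ⟨_, hd⟩ = QuotientGroup.mk (PathClass.conj (Path.Homotopic.Quotient.symm (.mk α))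
              (c.map (regularInclusion f))) := by
  have cov := hf.isCoveringMap_regularCovering
  let F : OrbifoldGroup₁ f b₁ →* OrbifoldGroup₀ f (regularCovering f b₁) :=
    QuotientGroup.map _ _ (FundamentalGroup.map (regularCovering f) b₁)
      fun g hg => map_regularCovering_mem_orbifoldKernel hf hP hp hg
  let I : OrbifoldGroup₁ f b₁ →* OrbifoldGroup₀ f (regularInclusion f b₁) :=
    QuotientGroup.map _ _ (FundamentalGroup.map (regularInclusion f) b₁)
      fun g hg => map_regularInclusion_mem_orbifoldKernel hf hP hp hg
  let A : OrbifoldGroup₀ f (regularInclusion f b₁) →* OrbifoldGroup₀ f (regularCovering f b₁) :=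
    QuotientGroup.map _ _ (PathClass.conj (Path.Homotopic.Quotient.symm (.mk α)))
      fun g hg => conj_mem_orbifoldKernel _ hg
  have hFinj : Function.Injective F := by
    rw [injective_iff_map_eq_one]
    intro x hx
    induction x using QuotientGroup.induction_on with | H g =>
    have h1 : FundamentalGroup.map (regularCovering f) b₁ g ∈ orbifoldKernel (regularSet₀ f)
      (weight₀ f) (regularCovering f b₁) := (QuotientGroup.eq_one_iff _).1 hx
    obtain ⟨h, hh, heq⟩ := exists_map_eq_of_mem_orbifoldKernel hf hP hp h1
    obtain rfl : h = g := cov.injective_path_homotopic_map _ _ heq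
    exact (QuotientGroup.eq_one_iff _).2 hh
  let e := MonoidHom.ofInjective hFinj
  have hφ : ∀ (h : F.range) (x : OrbifoldGroup₁ f b₁), F x = h →
      (A.comp (I.comp e.symm.toMonoidHom)) h = A (I x) := by
    intro h x hx
    have : e.symm h = x := by
      rw [MulEquiv.symm_apply_eq]
      exact Subtype.ext hx.symm
    change A (I (e.symm h)) = _
    rw [this]
  have hlift : ∀ d : FundamentalGroup (regularSet₀ f) (regularCovering f b₁),
      (QuotientGroup.mk d : OrbifoldGroup₀ f (regularCovering f b₁)) ∈ F.range →
        ∃ c : FundamentalGroup (regularSet₁ f) b₁,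
          FundamentalGroup.map (regularCovering f) b₁ c = d := by
    rintro d ⟨x, hx⟩
    induction x using QuotientGroup.induction_on with | H g =>
    obtain ⟨h, -, heq⟩ := exists_map_eq_of_mem_orbifoldKernel hf hP hp (QuotientGroup.eq.1 hx)
    exact ⟨g * h, by rw [map_mul, heq, mul_inv_cancel_left]⟩
  refine ⟨F.range, A.comp (I.comp e.symm.toMonoidHom), ?_,
    ⟨F, I, A, fun _ => rfl, fun _ => rfl, fun g => ?_, hFinj, rfl, hφ⟩, fun d hd => ?_⟩
  · have h1 := cov.finiteIndex_range_map b₁ (by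
      refine Finite.of_finite_image (f := Subtype.val) ((hf.finite_fiber (f b₁)).subset ?_)
        Subtype.val_injective.injOn
      rintro _ ⟨y, hy, rfl⟩
      exact congr_arg Subtype.val hy)
    have h2 : (FundamentalGroup.map (regularCovering f) b₁).range ≤
        F.range.comap (QuotientGroup.mk' _) := by
      rintro _ ⟨g, rfl⟩
      exact ⟨QuotientGroup.mk g, rfl⟩
    have h3 := Subgroup.finiteIndex_of_le h2
    rw [Subgroup.finiteIndex_iff] at h3 ⊢
    rwa [Subgroup.index_comap_of_surjective _ (QuotientGroup.mk'_surjective _)] at h3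
  · change QuotientGroup.mk (PathClass.conj _ g) = _
    rw [PathClass.conj_apply, PathClass.symm_symm]
    rfl
  · obtain ⟨c, rfl⟩ := hlift d hd
    exact ⟨c, rfl, hφ ⟨_, hd⟩ (QuotientGroup.mk c) rfl⟩

end Orbifold

/-- The element of the orbifold fundamental group represented by a loop. -/
abbrev orbifoldClass {X : Type*} [TopologicalSpace X] {U : Set X} {ν : X → ℕ} {b : U}
    (c : FundamentalGroup U b) : OrbifoldGroup U ν b :=
  QuotientGroup.mk c

theorem orbifoldClass_eq_conj {X : Type*} [TopologicalSpace X] {U : Set X} {ν : X → ℕ} {b : U}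
    (u c : PathClass b b) :
    (orbifoldClass c : OrbifoldGroup U ν b) =
      orbifoldClass u * orbifoldClass (PathClass.conj u c) * (orbifoldClass u)⁻¹ := by
  have : c = Path.Homotopic.Quotient.trans (Path.Homotopic.Quotient.symm u)
      (Path.Homotopic.Quotient.trans (PathClass.conj u c) u) := by
    rw [PathClass.conj_apply]; simp
  conv_lhs => rw [this]
  rfl

/-! ### Finiteness of small path classes in the orbifold -/

section Finiteness

variable {X : Type*} [MetricSpace X] {f : C(X, X)} {p : ℕ} {b : regularSet₀ f}

theorem exists_puncturedDisc (hf : IsBranchedCovering f) (hP : (postcriticalSet f).Finite) {x : X}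
    (hx : x ∈ postcriticalSet f) {V : Set X} (hV : V ∈ 𝓝 x) :
    ∃ D : PuncturedDisc (regularSet₀ f) x, D.disc ⊆ V := by
  obtain ⟨k, -, φ, -, hx', -, h0, -⟩ := hf.2 x
  obtain ⟨r, hr, h⟩ := φ.exists_radius hx' h0 hV hP
  obtain ⟨ht, hs⟩ := h r le_rfl
  refine ⟨⟨φ, r, hr, hx', h0, ht, fun z hz hz0 => (hs z hz).2 hz0, not_mem_regularSet₀.2 hx⟩,
    fun y hy => ?_⟩
  rw [← φ.left_inv hy.1]
  exact (hs _ hy.2).1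

/-- Every point of the surface has small neighbourhoods which are connected outside of the
punctures. -/
theorem exists_nhds_path (hf : IsBranchedCovering f) (hP : (postcriticalSet f).Finite) (x : X)
    {V : Set X} (hV : V ∈ 𝓝 x) : ∃ W ∈ 𝓝 x, W ⊆ V ∧ ∃ z : regularSet₀ f,
      ∀ y : regularSet₀ f, (y : X) ∈ W → ∃ q : Path y z, ∀ t, (q t : X) ∈ V := by
  by_cases hx : x ∈ postcriticalSet f
  · obtain ⟨D, hD⟩ := exists_puncturedDisc hf hP hx hV
    obtain ⟨a, -⟩ := D.exists_small_circle univ_mem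
    refine ⟨D.disc, D.disc_mem_nhds, hD, D.cover a, fun y hy => ?_⟩
    obtain ⟨w, rfl⟩ := D.exists_cover_eq hy
    exact ⟨(D.convex_halfPlane.segmentPath w a).map D.cover.continuous,
      fun t => hD (D.cover_mem_disc _)⟩
  · obtain ⟨r, hr, E, W, hW, s, hs, hE⟩ := exists_disc hf hP hx hV
    refine ⟨W, hW, fun w hw => ?_, E ⟨0, by simp [hr]⟩, fun y hy => ?_⟩
    · have := hE (s ⟨w, hw⟩)
      rwa [hs] at this
    · have hy' : y = E (s ⟨y, hy⟩) := Subtype.ext (hs ⟨y, hy⟩).symm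
      exact ⟨(((convex_ball (0 : ℂ) r).segmentPath (s ⟨y, hy⟩) ⟨0, by simp [hr]⟩).map
        E.continuous).cast hy' rfl, fun t => hE _⟩

/-- Points of `U₀` can be joined, by short paths in `U₀`, to finitely many of them. -/
theorem exists_finite_net [CompactSpace X] (hf : IsBranchedCovering f)
    (hP : (postcriticalSet f).Finite) {ε : ℝ} (hε : 0 < ε) :
    ∃ Z : Set (regularSet₀ f), Z.Finite ∧
      ∀ y : regularSet₀ f, ∃ z ∈ Z, ∃ q : Path y z, ∀ t, dist (q t) y < ε := by
  choose W hW hWV z hz using fun x : X =>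
    exists_nhds_path hf hP x (Metric.ball_mem_nhds x (half_pos hε))
  obtain ⟨s, -, hs⟩ := isCompact_univ.elim_nhds_subcover W fun x _ => hW x
  refine ⟨z '' s, s.finite_toSet.image z, fun y => ?_⟩
  obtain ⟨x, hx, hy⟩ := mem_iUnion₂.1 (hs (mem_univ (y : X)))
  obtain ⟨q, hq⟩ := hz x y hy
  refine ⟨z x, mem_image_of_mem z hx, q, fun t => ?_⟩
  have h1 := Metric.mem_ball.1 (hq t)
  have h2 := Metric.mem_ball.1 (hWV x hy)
  rw [Subtype.dist_eq]
  linarith [dist_triangle_right (q t : X) y x]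

/-- Up to the relations of the orbifold group there are only finitely many loops in a small
neighbourhood of a point. -/
theorem exists_nhds_finite_loops (hf : IsBranchedCovering f) (hP : (postcriticalSet f).Finite)
    (hp : ∀ n x, localDegree f^[n] x ≤ p) (x : X) :
    ∃ V ∈ 𝓝 x, ∀ (c : regularSet₀ f) (δ : PathClass b c),
      {γ : OrbifoldGroup₀ f b | ∃ β : Path c c, (∀ t, (β t : X) ∈ V) ∧
        γ = QuotientGroup.mk (PathClass.conj δ (Path.Homotopic.Quotient.mk β))}.Finite := by
  by_cases hx : x ∈ postcriticalSet f
  · obtain ⟨D, -⟩ := exists_puncturedDisc hf hP hx univ_mem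
    refine ⟨D.disc, D.disc_mem_nhds, fun c δ => ?_⟩
    by_cases hc : (c : X) ∈ D.disc
    · obtain ⟨a, rfl⟩ := D.exists_cover_eq hc
      set g : OrbifoldGroup₀ f b := QuotientGroup.mk (PathClass.conj δ (D.circleClass a 1)) with hg
      have hfin : IsOfFinOrder g := by
        rw [isOfFinOrder_iff_pow_eq_one]
        refine ⟨weight₀ f x, (weight₀_spec hf hp x).1, ?_⟩
        rw [hg, ← QuotientGroup.mk_pow, QuotientGroup.eq_one_iff]
        exact (D.isPeripheral_conj_circleClass δ 1).pow_mem_orbifoldKernel D.center_not_mem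
      refine (finite_zpowers.2 hfin).subset ?_
      rintro _ ⟨β, hβ, rfl⟩
      obtain ⟨m, hm⟩ := D.exists_circle β hβ rfl
      rw [Path.Homotopic.Quotient.cast_rfl_rfl] at hm
      exact ⟨m, by rw [hm, D.circleClass_eq_zpow, map_zpow, QuotientGroup.mk_zpow]⟩
    · refine finite_empty.subset ?_
      rintro _ ⟨β, hβ, -⟩
      exact hc (by simpa using hβ 0)
  · obtain ⟨V, hV, htriv⟩ := exists_nhds_loop_trivial hf hP hx
    refine ⟨V, hV, fun c δ => (finite_singleton 1).subset ?_⟩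
    rintro _ ⟨β, hβ, rfl⟩
    rw [htriv c β hβ]
    exact (QuotientGroup.eq_one_iff _).2 (by
      rw [show PathClass.conj δ (Path.Homotopic.Quotient.refl c) = 1 from map_one _]
      exact Subgroup.one_mem _)

/-- Up to the relations of the orbifold group, every loop which is a product of `n` small paths is,
after conjugation by a fixed loop `u`, a product of `n` members of a fixed finite set. -/
theorem exists_finite_alphabet [CompactSpace X] (hf : IsBranchedCovering f)
    (hP : (postcriticalSet f).Finite) (hp : ∀ n x, localDegree f^[n] x ≤ p) :
    ∃ ε > 0, ∃ T : Set (OrbifoldGroup₀ f b), T.Finite ∧ ∃ u : PathClass b b,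
      ∀ (c : PathClass b b) (n : ℕ), HasCost (smallSubsets (regularSet₀ f) ε) c n →
        ∃ l : List (OrbifoldGroup₀ f b), l.length = n ∧ (∀ s ∈ l, s ∈ T) ∧
          l.prod = orbifoldClass (PathClass.conj u c) := by
  choose V hV hVfin using fun x : X => exists_nhds_finite_loops (b := b) hf hP hp x
  obtain ⟨s, -, hs⟩ := isCompact_univ.elim_nhds_subcover (fun x => interior (V x))
    fun x _ => interior_mem_nhds.2 (hV x)
  obtain ⟨δ, hδ, hleb⟩ := lebesgue_number_lemma_of_metric isCompact_univ
    (c := fun x : s => interior (V x)) (fun x => isOpen_interior) (by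
      intro y hy
      obtain ⟨x, hx, hy⟩ := mem_iUnion₂.1 (hs hy)
      exact mem_iUnion.2 ⟨⟨x, hx⟩, hy⟩)
  have hε : 0 < δ / 4 := by positivity
  obtain ⟨Z, hZ, hq⟩ := exists_finite_net hf hP hε
  choose z hzZ q hqd using hq
  -- paths from the base point to the points of `Z` which can be reached from `b`
  let h : ∀ y : regularSet₀ f, Joined b y → PathClass b y := fun y hy => .mk hy.somePath
  have hjoin : ∀ y, Joined b y → Joined b (z y) := fun y hy => hy.trans ⟨q y⟩
  let w : ∀ y : regularSet₀ f, Joined b y → PathClass b y := fun y hy =>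
    (h (z y) (hjoin y hy)).trans (Path.Homotopic.Quotient.symm (.mk (q y)))
  -- the letters: paths between points of `Z` which run in one of the sets `V x`
  let B : regularSet₀ f → regularSet₀ f → s → Set (OrbifoldGroup₀ f b) := fun a a' x =>
    {γ | ∃ (ha : Joined b a) (ha' : Joined b a') (r : Path a a'), (∀ t, (r t : X) ∈ V x) ∧
      γ = orbifoldClass ((h a ha).trans
        (Path.Homotopic.Quotient.trans (.mk r) (h a' ha').symm))}
  have hB : ∀ a a' x, (B a a' x).Finite := by
    intro a a' x
    by_cases hne : (B a a' x).Nonempty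
    · obtain ⟨_, ha, ha', r₀, hr₀, rfl⟩ := hne
      refine ((hVfin x a (h a ha)).image fun γ => (orbifoldClass ((h a ha).trans
        (Path.Homotopic.Quotient.trans (.mk r₀) (h a' ha').symm)) : OrbifoldGroup₀ f b) * γ).subset ?_
      rintro _ ⟨_, _, r, hr, rfl⟩
      refine ⟨_, ⟨r.trans r₀.symm, fun t => ?_, rfl⟩, ?_⟩
      · have : (r.trans r₀.symm) t ∈ range r ∪ range r₀.symm := by
          rw [← Path.trans_range]; exact mem_range_self t
        rcases this with ⟨t', ht'⟩ | ⟨t', ht'⟩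
        · rw [← ht']; exact hr t'
        · rw [← ht']; exact hr₀ _
      · refine (QuotientGroup.mk_mul _ _ _).symm.trans (congr_arg _ ?_)
        change Path.Homotopic.Quotient.trans (PathClass.conj _ _) _ = _
        rw [PathClass.conj_apply, Path.Homotopic.Quotient.mk_trans, Path.Homotopic.Quotient.mk_symm]
        simp
    · rw [not_nonempty_iff_eq_empty.1 hne]; exact finite_empty
  refine ⟨δ / 4, hε, ⋃ a ∈ Z, ⋃ a' ∈ Z, ⋃ x, B a a' x,
    hZ.biUnion fun a _ => hZ.biUnion fun a' _ => finite_iUnion fun x => hB a a' x,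
    w b (Joined.refl b), fun c n hc => ?_⟩
  have key : ∀ {x y : regularSet₀ f} {c : PathClass x y} {n : ℕ},
      HasCost (smallSubsets (regularSet₀ f) (δ / 4)) c n → ∀ (hx : Joined b x) (hy : Joined b y),
        ∃ l : List (OrbifoldGroup₀ f b), l.length = n ∧
          (∀ s ∈ l, s ∈ ⋃ a ∈ Z, ⋃ a' ∈ Z, ⋃ x, B a a' x) ∧
          l.prod = orbifoldClass ((w x hx).trans (c.trans (w y hy).symm)) := by
    intro x y c n hc
    induction hc with
    | nil x =>
      intro hx hy
      refine ⟨[], rfl, by simp, ?_⟩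
      rw [Path.Homotopic.Quotient.refl_trans, Path.Homotopic.Quotient.trans_symm]
      rfl
    | @cons x y z' r c n W hW hr hc ih =>
      intro hx hz'
      have hy : Joined b y := hx.trans ⟨r⟩
      obtain ⟨l, hl, hlT, hprod⟩ := ih hy hz'
      refine ⟨l ++ [orbifoldClass ((w x hx).trans
        (Path.Homotopic.Quotient.trans (.mk r) (w y hy).symm))], by simp [hl], ?_, ?_⟩
      · intro s' hs'
        rcases List.mem_append.1 hs' with hs' | hs'
        · exact hlT s' hs'
        rw [List.mem_singleton.1 hs']
        obtain ⟨v, hv⟩ := hleb (x : X) (mem_univ _)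
        refine mem_iUnion₂.2 ⟨z x, hzZ x, mem_iUnion₂.2 ⟨z y, hzZ y, mem_iUnion.2 ⟨v, hjoin x hx,
          hjoin y hy, (q x).symm.trans (r.trans (q y)), fun t => ?_, ?_⟩⟩⟩
        · refine interior_subset (hv ?_)
          rw [Metric.mem_ball, ← Subtype.dist_eq]
          have hrd : ∀ t, dist (r t) x < δ / 4 := fun t => by
            simpa using hW _ (hr t) _ (hr 0)
          have : ((q x).symm.trans (r.trans (q y))) t ∈ range (q x) ∪ (range r ∪ range (q y)) := by
            rw [← Path.trans_range, ← Path.symm_range, ← Path.trans_range]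
            exact mem_range_self t
          rcases this with ⟨t', ht'⟩ | ⟨t', ht'⟩ | ⟨t', ht'⟩
          · rw [← ht']; linarith [hqd x t']
          · rw [← ht']; linarith [hrd t']
          · rw [← ht']
            have h1 := hrd 1
            rw [r.target] at h1
            linarith [hqd y t', dist_triangle (q y t') y x]
        · congr 1
          simp only [w, Path.Homotopic.Quotient.mk_trans, Path.Homotopic.Quotient.mk_symm,
            PathClass.symm_trans_rev, PathClass.symm_symm, Path.Homotopic.Quotient.trans_assoc]
      · rw [List.prod_append, List.prod_singleton, hprod]
        refine (QuotientGroup.mk_mul _ _ _).symm.trans (congr_arg _ ?_)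
        change Path.Homotopic.Quotient.trans (Path.Homotopic.Quotient.trans (w x hx) _) _ = _
        simp
  exact key hc (Joined.refl b) (Joined.refl b)

end Finiteness

/-! ### The iterates of the virtual endomorphism -/

/-- The cover of `U₀` by the sets `f⁻ⁿ(U)`, `U ∈ 𝓤`. -/
def preimageCover {X : Type*} [TopologicalSpace X] (f : C(X, X)) (𝓤 : Set (Set X)) (n : ℕ) :
    Set (Set (regularSet₀ f)) :=
  {W | ∃ U ∈ 𝓤, W = {x : regularSet₀ f | f^[n] x ∈ U}}

theorem PathClass.trans_cast {Y : Type*} [TopologicalSpace Y] {x y z z' : Y} (c : PathClass x y)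
    (d : PathClass y z) (h : z' = z) :
    c.trans (Path.Homotopic.Quotient.cast d rfl h) = (c.trans d).cast rfl h := by
  subst h; simp

section Iterates

variable {X : Type*} [MetricSpace X] {f : C(X, X)} {p : ℕ}

/-- The `n`-th iterate of the virtual endomorphism is computed by lifting a loop through `fⁿ` and
joining the lift to the base point by a path which does not depend on the loop. -/
theorem exists_iterate_eq [CompactSpace X] (hf : IsBranchedCovering f) {b₁ : regularSet₁ f} (𝓤 : Set (Set X))
    (α : Path (regularInclusion f b₁) (regularCovering f b₁))
    {H : Subgroup (OrbifoldGroup₀ f (regularCovering f b₁))}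
    {φ : H →* OrbifoldGroup₀ f (regularCovering f b₁)}
    (hφ : ∀ d : FundamentalGroup (regularSet₀ f) (regularCovering f b₁),
        ∀ hd : (QuotientGroup.mk d : OrbifoldGroup₀ f (regularCovering f b₁)) ∈ H,
          ∃ c : PathClass b₁ b₁, c.map (regularCovering f) = d ∧
            φ ⟨_, hd⟩ = QuotientGroup.mk (PathClass.conj (Path.Homotopic.Quotient.symm (.mk α))
              (c.map (regularInclusion f)))) (n : ℕ) :
    ∃ (b : regularSet₀ f) (η : PathClass (regularCovering f b₁) b),
      ∀ (d : PathClass (regularCovering f b₁) (regularCovering f b₁)) (m : ℕ),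
        HasCost (preimageCover f 𝓤 0) d m → orbifoldClass d ∈ iterateDomain φ n →
          ∃ c : PathClass b b, HasCost (preimageCover f 𝓤 n) c m ∧
            (extendByOne φ)^[n] (orbifoldClass d) = orbifoldClass (PathClass.conj η c) := by
  have cov := hf.isCoveringMap_regularCovering
  induction n with
  | zero =>
    refine ⟨_, Path.Homotopic.Quotient.refl _, fun d m hd _ => ⟨d, hd, ?_⟩⟩
    rw [PathClass.conj_apply]
    simp
  | succ n ih =>
    obtain ⟨b, η, h⟩ := ih
    obtain ⟨e, rfl, ε, hε⟩ := cov.exists_class_lift η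
    rw [Path.Homotopic.Quotient.cast_rfl_rfl] at hε
    refine ⟨regularInclusion f e, (Path.Homotopic.Quotient.symm (.mk α)).trans
      (ε.map (regularInclusion f)), fun d m hd hdom => ?_⟩
    obtain ⟨hdom1, hdom2⟩ := (mem_iterateDomain_add n 1 _).1 hdom
    obtain ⟨c, hc, heq⟩ := h d m hd hdom1
    rw [heq] at hdom2
    obtain ⟨hH, -⟩ := hdom2
    obtain ⟨c₁, hc₁, hφc₁⟩ := hφ _ hH
    obtain ⟨e', he', c', hc', hcost⟩ := hc.exists_lift cov (e := e) rfl
    -- the lift of `c` starting at the end point of `ε` is closed, by uniqueness of lifts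
    obtain ⟨rfl, hcc⟩ := cov.class_lift_unique (ε.trans c') (Path.Homotopic.Quotient.trans c₁ ε)
      he' (by
        rw [PathClass.map_trans, PathClass.map_trans, hc', hc₁, PathClass.trans_cast, hε,
          PathClass.conj_apply]
        simp)
    rw [Path.Homotopic.Quotient.cast_rfl_rfl] at hcc
    have hc₁' : c₁ = PathClass.conj ε c' := by
      rw [PathClass.conj_apply, ← Path.Homotopic.Quotient.trans_assoc, hcc]
      simp
    refine ⟨c'.map (regularInclusion f), hcost.map _ ?_, ?_⟩
    · rintro _ ⟨_, ⟨U, hU, rfl⟩, rfl⟩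
      exact ⟨_, ⟨U, hU, rfl⟩, fun x hx => hx⟩
    · rw [Function.iterate_succ_apply', heq, extendByOne_of_mem hH, hφc₁, hc₁',
        PathClass.conj_trans]
      exact congr_arg _ (congr_arg _ (PathClass.map_conj _ _ _))

/-- Every element of the orbifold group is represented by a loop with cost bounded linearly by the
word length. -/
theorem exists_loop_cost_le {b : regularSet₀ f} {𝓦 : Set (Set (regularSet₀ f))}
    (hO : ∀ W ∈ 𝓦, IsOpen W) (hcov : ⋃₀ 𝓦 = univ) {S : Set (OrbifoldGroup₀ f b)} (hS : S.Finite)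
    (hgen : Subgroup.closure S = ⊤) : ∃ K : ℕ, 0 < K ∧ ∀ g : OrbifoldGroup₀ f b,
      ∃ (d : PathClass b b) (n : ℕ), orbifoldClass d = g ∧ HasCost 𝓦 d n ∧
        n ≤ K * wordLength S g := by
  have hrep : ∀ g : OrbifoldGroup₀ f b, ∃ (d : PathClass b b) (n : ℕ),
      orbifoldClass d = g ∧ HasCost 𝓦 d n := by
    intro g
    induction g using QuotientGroup.induction_on with | H d =>
    obtain ⟨n, hn⟩ := HasCost.exists_of_isOpen_cover hO hcov (x := b) (y := b) d
    exact ⟨d, n, rfl, hn⟩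
  choose d n hd hn using hrep
  obtain ⟨K, hK⟩ := (hS.image n).bddAbove
  refine ⟨K + 1, K.succ_pos, fun g => ?_⟩
  obtain ⟨l, hl, hlS, rfl⟩ := exists_word hgen g
  rw [← hl]
  clear hl
  induction l with
  | nil => exact ⟨_, 0, rfl, HasCost.nil b, Nat.zero_le _⟩
  | cons a l ih =>
    obtain ⟨d₁, n₁, hd₁, hc₁, hn₁⟩ := ih fun s hs => hlS s (List.mem_cons_of_mem _ hs)
    obtain ⟨d₂, n₂, hd₂, hc₂, hn₂⟩ : ∃ (d₂ : PathClass b b) (n₂ : ℕ),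
        orbifoldClass d₂ = a ∧ HasCost 𝓦 d₂ n₂ ∧ n₂ ≤ K := by
      rcases hlS a List.mem_cons_self with ha | ha
      · exact ⟨d a, n a, hd a, hn a, hK (mem_image_of_mem n ha)⟩
      · refine ⟨(d a⁻¹).symm, n a⁻¹, ?_, (hn a⁻¹).symm, hK (mem_image_of_mem n ha)⟩
        have : orbifoldClass (Path.Homotopic.Quotient.symm (d a⁻¹)) =
          (orbifoldClass (d a⁻¹) : OrbifoldGroup₀ f b)⁻¹ := rfl
        rw [this, hd, inv_inv]
    refine ⟨d₁.trans d₂, n₁ + n₂, ?_, hc₁.trans hc₂, ?_⟩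
    · have : (orbifoldClass (Path.Homotopic.Quotient.trans d₁ d₂) : OrbifoldGroup₀ f b) =
        orbifoldClass d₂ * orbifoldClass d₁ := rfl
      rw [this, hd₁, hd₂, List.prod_cons]
    · rw [List.length_cons, Nat.mul_succ]
      omega

theorem exists_cost_smallSubsets {Y : Type*} [PseudoMetricSpace Y] {ε : ℝ} (hε : 0 < ε) {x y : Y}
    (c : PathClass x y) : ∃ n, HasCost (smallSubsets Y ε) c n := by
  obtain ⟨n, hn⟩ := HasCost.exists_of_isOpen_cover (𝓦 := range fun z : Y => Metric.ball z (ε / 2))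
    (by rintro _ ⟨z, rfl⟩; exact Metric.isOpen_ball)
    (sUnion_eq_univ_iff.2 fun z => ⟨_, ⟨z, rfl⟩, Metric.mem_ball_self (half_pos hε)⟩) c
  refine ⟨n, hn.of_path ?_⟩
  rintro _ ⟨z, rfl⟩ x y q hq
  refine ⟨_, fun a ha a' ha' => ?_, hq⟩
  have h1 := Metric.mem_ball.1 ha
  have h2 := Metric.mem_ball.1 ha'
  linarith [dist_triangle_right a a' z]

theorem orbifoldGroup₀_fg [CompactSpace X] (hf : IsBranchedCovering f) (hP : (postcriticalSet f).Finite)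
    (hp : ∀ n x, localDegree f^[n] x ≤ p) (b : regularSet₀ f) : Group.FG (OrbifoldGroup₀ f b) := by
  obtain ⟨ε, hε, T, hT, u, h⟩ := exists_finite_alphabet (b := b) hf hP hp
  refine Group.fg_iff.2 ⟨T, eq_top_iff.2 fun g _ => ?_, hT⟩
  induction g using QuotientGroup.induction_on with | H d =>
  obtain ⟨n, hn⟩ := exists_cost_smallSubsets hε
    (PathClass.conj (Path.Homotopic.Quotient.symm u) d : PathClass b b)
  obtain ⟨l, -, hlT, hl⟩ := h _ n hn
  have : PathClass.conj u (PathClass.conj (Path.Homotopic.Quotient.symm u) d) = d := by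
    rw [← PathClass.conj_trans, Path.Homotopic.Quotient.trans_symm, PathClass.conj_apply]
    simp
  rw [this] at hl
  change orbifoldClass d ∈ _
  rw [← hl]
  exact Subgroup.list_prod_mem _ fun s hs => Subgroup.subset_closure (hlT s hs)

/-- Paths which run in a member of `𝓦` lifted `n` times are small, for large `n`, by expansion. -/
theorem AxiomExpansion.hasCost_smallSubsets [CompactSpace X] {𝓤 : Set (Set X)} (h : AxiomExpansion f 𝓤) {ε : ℝ}
    (hε : 0 < ε) : ∃ N : ℕ, ∀ n ≥ N, ∀ {x y : regularSet₀ f} {c : PathClass x y} {m : ℕ},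
      HasCost (preimageCover f 𝓤 n) c m → HasCost (smallSubsets (regularSet₀ f) ε) c m := by
  obtain ⟨s, -, hs⟩ := isCompact_univ.elim_nhds_subcover (fun x : X => Metric.ball x (ε / 2))
    fun x _ => Metric.ball_mem_nhds x (half_pos hε)
  obtain ⟨N, hN⟩ := h ((fun x : X => Metric.ball x (ε / 2)) '' s) (s.finite_toSet.image _)
    (by rintro _ ⟨x, -, rfl⟩; exact Metric.isOpen_ball)
    (by rw [sUnion_image]; exact univ_subset_iff.1 hs)
  refine ⟨N, fun n hn x y c m hc => hc.of_path ?_⟩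
  rintro _ ⟨U, hU, rfl⟩ x y q hq
  obtain ⟨_, ⟨z, -, rfl⟩, hz⟩ := hN n hn _ ⟨U, hU, x, by simpa using hq 0, rfl⟩
  refine ⟨range q, ?_, fun t => mem_range_self t⟩
  have hmem : ∀ t, (q t : X) ∈ Metric.ball z (ε / 2) := by
    intro t
    refine hz ((isPreconnected_range (f := fun t => (q t : X))
      (by fun_prop)).subset_connectedComponentIn ⟨0, by simp⟩ ?_ (mem_range_self t))
    rintro _ ⟨t, rfl⟩
    exact hq t
  rintro _ ⟨t, rfl⟩ _ ⟨t', rfl⟩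
  have h1 := Metric.mem_ball.1 (hmem t)
  have h2 := Metric.mem_ball.1 (hmem t')
  rw [Subtype.dist_eq]
  linarith [dist_triangle_right (q t : X) (q t') z]

/-- The virtual endomorphism of an expanding map contracts. A word of length `w` is a product of at
most `K w` paths which run in members of `𝓤`; their lifts under `fⁿ` are so small that `M` of them
in a row still form a small path, which is one of finitely many letters. -/
theorem IsTopologicallyCXC.contractionRatio_lt_one [CompactSpace X]
    [LocallyConnectedSpace X] (hf : IsTopologicallyCXC f) (hP : (postcriticalSet f).Finite) {b₁ : regularSet₁ f}
    (α : Path (regularInclusion f b₁) (regularCovering f b₁))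
    {H : Subgroup (OrbifoldGroup₀ f (regularCovering f b₁))}
    {φ : H →* OrbifoldGroup₀ f (regularCovering f b₁)}
    (hφ : ∀ d : FundamentalGroup (regularSet₀ f) (regularCovering f b₁),
        ∀ hd : (QuotientGroup.mk d : OrbifoldGroup₀ f (regularCovering f b₁)) ∈ H,
          ∃ c : PathClass b₁ b₁, c.map (regularCovering f) = d ∧
            φ ⟨_, hd⟩ = QuotientGroup.mk (PathClass.conj (Path.Homotopic.Quotient.symm (.mk α))
              (c.map (regularInclusion f))))
    {S : Set (OrbifoldGroup₀ f (regularCovering f b₁))} (hS : S.Finite)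
    (hgen : Subgroup.closure S = ⊤) : contractionRatio S φ < 1 := by
  obtain ⟨p, hp⟩ := hf.exists_localDegree_le
  obtain ⟨hbr, -, 𝓤, -, hU, hcov, hexp, -, -⟩ := hf
  obtain ⟨ε, hε, T, hT, u, hTu⟩ := exists_finite_alphabet (b := regularCovering f b₁) hbr hP hp
  obtain ⟨K, hK0, hK⟩ := exists_loop_cost_le (𝓦 := preimageCover f 𝓤 0)
    (by
      rintro _ ⟨U, hUm, rfl⟩
      exact (hU U hUm).1.preimage continuous_subtype_val)
    (sUnion_eq_univ_iff.2 fun x => by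
      obtain ⟨U, hUm, hx⟩ : (x : X) ∈ ⋃₀ 𝓤 := hcov ▸ mem_univ _
      exact ⟨_, ⟨U, hUm, rfl⟩, hx⟩) hS hgen
  obtain ⟨C, hC⟩ := (hT.image (wordLength S)).bddAbove
  set M := 2 * C * K + 1 with hM
  have hM0 : (0 : ℝ) < 3 * M := by rw [hM]; positivity
  obtain ⟨N, hN⟩ := hexp.hasCost_smallSubsets (ε := ε / (3 * M)) (by positivity)
  refine _root_.contractionRatio_lt_one (N := N) fun n hn => ?_
  obtain ⟨b, η, hη⟩ := exists_iterate_eq hbr 𝓤 α hφ n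
  obtain ⟨k, hk⟩ := exists_cost_smallSubsets hε η
  refine ⟨2 * (wordLength S (orbifoldClass u) + C * (2 * k + 1) +
    wordLength S (orbifoldClass u)⁻¹), fun g hg => ?_⟩
  obtain ⟨d, m, rfl, hd, hm⟩ := hK g
  obtain ⟨c, hc, heq⟩ := hη d m hd hg
  have h1 := (hN n hn hc).coarsen (by positivity) (M := M) (by omega)
  rw [mul_div_cancel₀ _ hM0.ne'] at h1
  obtain ⟨l, hl, hlT, hprod⟩ := hTu (PathClass.conj η c) _ (hk.trans (h1.trans hk.symm))
  have h2 := wordLength_prod_le hgen l fun s hs => hC (mem_image_of_mem _ (hlT s hs))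
  rw [hprod, hl] at h2
  rw [heq, orbifoldClass_eq_conj u]
  have h3 := wordLength_mul_le hgen (orbifoldClass u * orbifoldClass (PathClass.conj u
    (PathClass.conj η c))) (orbifoldClass u)⁻¹
  have h4 := wordLength_mul_le hgen (orbifoldClass u) (orbifoldClass (PathClass.conj u
    (PathClass.conj η c)))
  set w := wordLength S (orbifoldClass d)
  -- the choice of `M`
  have h5 : 2 * C * (m / M) ≤ w := by
    have h6 : M * (m / M) ≤ K * w := (Nat.mul_div_le m M).trans hm
    refine Nat.le_of_mul_le_mul_left (c := K) ?_ hK0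
    calc K * (2 * C * (m / M)) = 2 * C * K * (m / M) := by ring
      _ ≤ M * (m / M) := Nat.mul_le_mul_right _ (by omega)
      _ ≤ K * w := h6
  have h7 : C * (k + (m / M + 1 + k)) = C * (2 * k + 1) + C * (m / M) := by ring
  rw [h7] at h2
  rw [mul_assoc] at h5
  omega

end Iterates

theorem mainTheorem5 (f : C(Sphere2, Sphere2)) (hf : IsTopologicallyCXC f)
    (hP : (postcriticalSet f).Finite) (b₁ : regularSet₁ f)
    (α : Path (regularInclusion f b₁) (regularCovering f b₁)) :
    ∃ (H : Subgroup (OrbifoldGroup₀ f (regularCovering f b₁)))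
      (φ : H →* OrbifoldGroup₀ f (regularCovering f b₁)),
      H.FiniteIndex ∧ IsVirtualEndomorphism f b₁ α H φ ∧ IsContracting φ := by
  have : LocallyConnectedSpace Sphere2 :=
    ChartedSpace.locallyConnectedSpace (EuclideanSpace ℝ (Fin 2)) Sphere2
  obtain ⟨p, hp⟩ := hf.exists_localDegree_le
  obtain ⟨H, φ, hfin, hvirt, hφ⟩ := exists_isVirtualEndomorphism hf.1 hP hp α
  exact ⟨H, φ, hfin, hvirt, orbifoldGroup₀_fg hf.1 hP hp _,
    fun S hS hgen => hf.contractionRatio_lt_one hP α hφ hS hgen⟩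

end
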